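/- A triangulation of a lattice polygon $P\subset\mathbb{R}^2$ (possibly degenerate) is a geometric simplicial complex that subdivides $P$ and whose vertices lie in $P\cap\mathbb{Z}^2$. It is fine if every point of $P\cap\mathbb{Z}^2$ is a vertex of it, and regular if, for some heights $\omega:P\cap\mathbb{Z}^2\to\mathbb{R}$, its simplices are exactly the projections of the lower faces of $\mathrm{conv}\{(p,\omega(p)) : p\in P\cap\mathbb{Z}^2\}\subset\mathbb{R}^3$. For integers $n,k\ge 0$ let $f(2;n,k)$ and $f^{\mathrm{reg}}(2;n,k)$ denote the number of fine triangulations and of fine regular triangulations, respectively, of the right lattice trapezoid $\mathrm{conv}\{(0,0),(0,n),(2,0),(2,n+2k)\}$, and for integers $A,B\ge 0$ let $g_2(A,B)$ denote the number of fine triangulations of $\mathrm{conv}\{(0,0),(0,A),(2,0),(2,B)\}$. Then, for all integers $n,k\ge 0$, $$f(2;n,k)=\binom{2n+k}{n}\binom{2n+3k}{n+2k}+\sum_{\substack{0\le A\le n\\ 0\le B\le n+2k\\ A+B\equiv 1\ (\mathrm{mod}\ 2)}} g_2(A,B)\binom{2n+k-\frac{3A+B+1}{2}}{n-A}\binom{2n+3k-\frac{A+3B+1}{2}}{n+2k-B},$$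 and moreover $$f^{\mathrm{reg}}(2;n,k)=f(2;n,k).$$ -/

import Mathlib

open Geometry

/-- The points of `P ⊆ ℝ²` with integer coordinates. -/
def latticePoints (P : Set (ℝ × ℝ)) : Set (ℝ × ℝ) :=
  {p | p ∈ P ∧ ∃ a b : ℤ, p = ((a : ℝ), (b : ℝ))}

/-- A triangulation of `P`: a (geometric) simplicial complex that subdivides `P`
and whose vertices are lattice points of `P`. -/
def IsLatticeTriangulation (P : Set (ℝ × ℝ)) (T : SimplicialComplex ℝ (ℝ × ℝ)) : Prop :=
  T.space = P ∧ T.vertices ⊆ latticePoints P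

/-- A triangulation of `P` is fine if every lattice point of `P` is a vertex of it. -/
def IsFineTriangulation (P : Set (ℝ × ℝ)) (T : SimplicialComplex ℝ (ℝ × ℝ)) : Prop :=
  IsLatticeTriangulation P T ∧ latticePoints P ⊆ T.vertices

/-- The convex hull in `ℝ² × ℝ` of the lattice points `p` of `P`, lifted to the heights `ω p`. -/
def liftedPolytope (P : Set (ℝ × ℝ)) (ω : ℝ × ℝ → ℝ) : Set ((ℝ × ℝ) × ℝ) :=
  convexHull ℝ ((fun p => (p, ω p)) '' latticePoints P)

/-- `F` is a lower face of `Q ⊆ ℝ² × ℝ`: the (nonempty) set of the points of `Q` at which some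
linear functional with positive last coefficient, normalised to `1`, attains its minimum on `Q`. -/
def IsLowerFace (Q F : Set ((ℝ × ℝ) × ℝ)) : Prop :=
  F.Nonempty ∧ ∃ l : (ℝ × ℝ) →ₗ[ℝ] ℝ,
    F = {q | q ∈ Q ∧ ∀ q' ∈ Q, l q.1 + q.2 ≤ l q'.1 + q'.2}

/-- A triangulation `T` of `P` is regular if, for some heights `ω` on the lattice points of `P`,
its simplices are exactly the projections of the lower faces of the lifted polytope. -/
def IsRegularTriangulation (P : Set (ℝ × ℝ)) (T : SimplicialComplex ℝ (ℝ × ℝ)) : Prop :=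
  ∃ ω : ℝ × ℝ → ℝ,
    {S | ∃ s ∈ T.faces, S = convexHull ℝ (s : Set (ℝ × ℝ))} =
      {S | ∃ F, IsLowerFace (liftedPolytope P ω) F ∧ S = Prod.fst '' F}

/-- The number of fine triangulations of `P`. -/
noncomputable def numFT (P : Set (ℝ × ℝ)) : ℕ :=
  {T : SimplicialComplex ℝ (ℝ × ℝ) | IsFineTriangulation P T}.ncard

/-- The number of fine regular triangulations of `P`. -/
noncomputable def numFRT (P : Set (ℝ × ℝ)) : ℕ :=
  {T : SimplicialComplex ℝ (ℝ × ℝ) |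
    IsFineTriangulation P T ∧ IsRegularTriangulation P T}.ncard

/-- The right trapezoid of width 2 with vertices `(0,0)`, `(0,a)`, `(2,0)`, `(2,b)`. -/
def rightTrapezoid (a b : ℕ) : Set (ℝ × ℝ) :=
  convexHull ℝ {((0 : ℝ), (0 : ℝ)), ((0 : ℝ), (a : ℝ)), ((2 : ℝ), (0 : ℝ)), ((2 : ℝ), (b : ℝ))}

/-- `g₂(A,B)`: the number of fine triangulations of `conv{(0,0),(0,A),(2,0),(2,B)}`. -/
noncomputable def gTwo (A B : ℕ) : ℕ := numFT (rightTrapezoid A B)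

/-- `f(2;n,k)`: the number of fine triangulations of `conv{(0,0),(0,n),(2,0),(2,n+2k)}`. -/
noncomputable def fTwo (n k : ℕ) : ℕ := numFT (rightTrapezoid n (n + 2 * k))

/-- `f^reg(2;n,k)`: the number of fine regular triangulations of the same trapezoid. -/
noncomputable def fRegTwo (n k : ℕ) : ℕ := numFRT (rightTrapezoid n (n + 2 * k))

/-! All lattice points lie on the columns of abscissa 0, 1 and 2, and no triangle of a fine
triangulation contains a lattice point besides its vertices. Consider the unit segment from (1, c)
to (1, c + 1). Either it is an edge, with apices (0, a) and (2, b) of the triangles on its two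
sides, or it is crossed by an edge from (0, a) to (2, b). In the second case emptiness forces a + b
= 2c + 1, and the crossing edge is a diagonal of the parallelogram whose other diagonal is the
segment. Triangles with a unit edge in an outer column fill the gaps between consecutive apices. If
A + B is odd, one more triangle under the top edge closes the figure.

Hence a fine triangulation is a list of rows (a, b, flag), with a and b weakly increasing upwards
and the flag allowed only if a + b = 2c + 1. Sweeping a front through (0, a), (1, c), (2, b) upwards
reads such a list off any fine triangulation (`exists_rows`). Conversely each list yields one
(`exists_triangulation`), and the correspondence is bijective by `eq_of_cells_subset` and
`eq_of_totalCells_subset`.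

Regularity comes from the same sweep: heights are chosen point by point, each new cell lying on a
steeper plane than all earlier ones (`HasHeights`). So every list gives a regular triangulation, and
there are no others.

For the count, split by the last flagged row. Without flags the two apex sequences are independent
weakly increasing sequences, which gives the product of binomials. If the last flag is in row j with
apices x and y, then x + y = 2j + 1. The rows below it are those of a trapezoid counted by `gTwo x
y`, and the rows above it are unflagged, which gives two binomials again (`card_rowLists`). -/

/-! ### Affine functions on the plane -/

/-- The affine function on the plane with coefficients `c`. -/
def affVal (c : ℝ × ℝ × ℝ) (v : ℝ × ℝ) : ℝ := c.1 + c.2.1 * v.1 + c.2.2 * v.2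

lemma affVal_sum (c : ℝ × ℝ × ℝ) {s : Finset (ℝ × ℝ)} {w : ℝ × ℝ → ℝ}
    (hw : ∑ v ∈ s, w v = 1) :
    affVal c (∑ v ∈ s, w v • v) = ∑ v ∈ s, w v * affVal c v := by
  have h1 : ∑ v ∈ s, w v * affVal c v =
      c.1 * ∑ v ∈ s, w v + c.2.1 * ∑ v ∈ s, w v * v.1 + c.2.2 * ∑ v ∈ s, w v * v.2 := by
    simp only [Finset.mul_sum, ← Finset.sum_add_distrib, affVal]
    exact Finset.sum_congr rfl fun v _ => by ring
  rw [h1, hw]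
  simp [affVal, Prod.fst_sum, Prod.snd_sum]

lemma affVal_add_smul (c : ℝ × ℝ × ℝ) (t : ℝ) (p q : ℝ × ℝ) :
    affVal c (p + t • (q - p)) = (1 - t) * affVal c p + t * affVal c q := by
  simp [affVal]; ring

lemma exists_affVal_eq (f : (ℝ × ℝ) →ᵃ[ℝ] ℝ) : ∃ c, ∀ v, affVal c v = f v := by
  refine ⟨(f 0, f.linear (1, 0), f.linear (0, 1)), fun v => ?_⟩
  have h : f v = f.linear v + f 0 := by
    simpa using f.map_vadd 0 v
  have h2 : v = v.1 • ((1 : ℝ), (0 : ℝ)) + v.2 • ((0 : ℝ), (1 : ℝ)) := by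
    ext <;> simp
  rw [h]
  conv_rhs => rw [h2, map_add, map_smul, map_smul]
  simp [affVal]; ring

/-- An affine function nonzero at just one vertex, applied to an affine relation, isolates the
coefficient of that vertex. -/
lemma affineIndependent_of_affVal {s : Finset (ℝ × ℝ)}
    (h : ∀ v ∈ s, ∃ c, affVal c v ≠ 0 ∧ ∀ u ∈ s, u ≠ v → affVal c u = 0) :
    AffineIndependent ℝ ((↑) : s → ℝ × ℝ) := by
  classical
  rw [affineIndependent_iff]
  intro t w hw ht i hi
  obtain ⟨c, hc, hc'⟩ := h i i.2
  have key : ∑ j ∈ t, w j * affVal c j = 0 := by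
    have h1 : ∑ j ∈ t, w j * affVal c j =
        c.1 * ∑ v ∈ t, w v + c.2.1 * (∑ v ∈ t, w v • (v : ℝ × ℝ)).1
          + c.2.2 * (∑ v ∈ t, w v • (v : ℝ × ℝ)).2 := by
      simp only [Prod.fst_sum, Prod.snd_sum, Finset.mul_sum, ← Finset.sum_add_distrib, affVal]
      exact Finset.sum_congr rfl fun v _ => by simp; ring
    rw [h1, hw, ht]; simp
  rw [Finset.sum_eq_single i] at key
  · exact (mul_eq_zero.1 key).resolve_right hc
  · intro j _ hj
    rw [hc' j j.2 (fun e => hj (Subtype.ext e)), mul_zero]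
  · exact fun h => absurd hi h

/-- Complete `s` to an affine basis and add up the barycentric coordinates of the basis points
outside `t`. The function separates one part of a simplex from the rest. -/
lemma AffineIndependent.exists_affVal {s : Finset (ℝ × ℝ)}
    (hs : AffineIndependent ℝ ((↑) : s → ℝ × ℝ)) (t : Set (ℝ × ℝ)) :
    ∃ c, (∀ v ∈ s, v ∈ t → affVal c v = 0) ∧ ∀ v ∈ s, v ∉ t → affVal c v = 1 := by
  classical
  have hs' : AffineIndependent ℝ ((↑) : ↥(s : Set (ℝ × ℝ)) → ℝ × ℝ) := hs
  obtain ⟨u, hsu, hu, hspan⟩ := exists_subset_affineIndependent_affineSpan_eq_top hs'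
  let b : AffineBasis u ℝ (ℝ × ℝ) := ⟨fun i => i.1, hu, by simpa using hspan⟩
  have : Fintype u := by
    have := finite_set_of_fin_dim_affineIndependent ℝ hu
    exact this.fintype
  obtain ⟨c, hc⟩ := exists_affVal_eq (∑ i : u, if (i : ℝ × ℝ) ∈ t then 0 else b.coord i)
  have hc' : ∀ v (hv : v ∈ u), affVal c v = if v ∈ t then 0 else 1 := by
    intro v hv
    rw [hc]
    have : ∀ i : u, (if (i : ℝ × ℝ) ∈ t then (0 : (ℝ × ℝ) →ᵃ[ℝ] ℝ) else b.coord i) v =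
        if (⟨v, hv⟩ : u) = i then (if v ∈ t then 0 else 1) else 0 := by
      intro i
      by_cases hi : (⟨v, hv⟩ : u) = i
      · subst hi
        by_cases hvt : v ∈ t
        · simp [hvt]
        · simp only [hvt, if_false, if_true]
          exact b.coord_apply_eq ⟨v, hv⟩
      · simp only [hi, if_false]
        split_ifs
        · simp
        · exact b.coord_apply_ne (j := ⟨v, hv⟩) (fun e => hi e.symm)
    have h2 : ∀ (S : Finset u) (g : u → (ℝ × ℝ) →ᵃ[ℝ] ℝ), (∑ i ∈ S, g i) v = ∑ i ∈ S, g i v := by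
      intro S g
      induction S using Finset.induction_on with
      | empty => simp
      | insert a S ha ih => simp [Finset.sum_insert ha, ih]
    rw [h2, Finset.sum_congr rfl fun i _ => this i]
    simp
  exact ⟨c, fun v hv hvt => by rw [hc' v (hsu hv), if_pos hvt],
    fun v hv hvt => by rw [hc' v (hsu hv), if_neg hvt]⟩

lemma affVal_nonneg_of_mem_convexHull {c : ℝ × ℝ × ℝ} {s : Set (ℝ × ℝ)} {x : ℝ × ℝ}
    (h : ∀ v ∈ s, 0 ≤ affVal c v) (hx : x ∈ convexHull ℝ s) : 0 ≤ affVal c x := by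
  have : Convex ℝ {v | 0 ≤ affVal c v} := by
    intro p hp q hq a b ha hb hab
    have : affVal c (a • p + b • q) = a * affVal c p + b * affVal c q := by
      have : c.1 = a * c.1 + b * c.1 := by rw [← add_mul, hab, one_mul]
      simp [affVal]; linear_combination this
    simp only [Set.mem_ofPred_eq] at *
    rw [this]; positivity
  exact convexHull_min h this hx

/-! ### Faces of a planar simplicial complex -/

namespace Geometry.SimplicialComplex

variable {T : SimplicialComplex ℝ (ℝ × ℝ)}

/-- A face which has a relative interior point in common with another face is contained in it. -/
lemma subset_of_mem_convexHull {s t : Finset (ℝ × ℝ)} (hs : s ∈ T.faces) (ht : t ∈ T.faces)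
    {w : ℝ × ℝ → ℝ} (hw : ∀ v ∈ s, 0 < w v) (hw1 : ∑ v ∈ s, w v = 1)
    (hx : ∑ v ∈ s, w v • v ∈ convexHull ℝ (t : Set (ℝ × ℝ))) : s ⊆ t := by
  classical
  intro v hv
  by_contra hvt
  obtain ⟨c, hc0, hc1⟩ := (T.indep hs).exists_affVal (t : Set (ℝ × ℝ))
  have hxs : ∑ v ∈ s, w v • v ∈ convexHull ℝ (s : Set (ℝ × ℝ)) :=
    Finset.mem_convexHull'.2 ⟨w, fun v hv => (hw v hv).le, hw1, rfl⟩
  -- The point lies in the hull of `s ∩ t`, where `c` vanishes, while a vertex of `s` outside `t`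
  -- would carry positive weight and make the value of `c` positive.
  have hxst := T.inter_subset_convexHull hs ht ⟨hxs, hx⟩
  have h0 : 0 ≤ affVal (-c) (∑ v ∈ s, w v • v) :=
    affVal_nonneg_of_mem_convexHull (fun u hu => by
      have := hc0 u hu.1 hu.2
      simp [affVal] at this ⊢; linarith) hxst
  have h1 : 0 < affVal c (∑ v ∈ s, w v • v) := by
    rw [affVal_sum c hw1]
    refine Finset.sum_pos' (fun u hu => ?_) ⟨v, hv, ?_⟩
    · by_cases hut : u ∈ t
      · rw [hc0 u hu hut, mul_zero]
      · rw [hc1 u hu hut, mul_one]; exact (hw u hu).le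
    · rw [hc1 v hv hvt, mul_one]; exact hw v hv
  simp [affVal] at h0 h1
  linarith

/-- The centroid of a face lies in no other face than those containing the face. -/
lemma subset_of_centroid_mem {s t : Finset (ℝ × ℝ)} (hs : s ∈ T.faces) (ht : t ∈ T.faces)
    (hx : ∑ v ∈ s, (s.card : ℝ)⁻¹ • v ∈ convexHull ℝ (t : Set (ℝ × ℝ))) : s ⊆ t := by
  have hc : (0 : ℝ) < s.card := by
    exact_mod_cast (nonempty_of_mem_faces hs).card_pos
  refine subset_of_mem_convexHull hs ht (w := fun _ => (s.card : ℝ)⁻¹)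
    (fun _ _ => by positivity) ?_ hx
  simp [hc.ne']

/-- Move slightly from the centroid of `s` towards `x`. Faces are closed and finite in number, so
the point reached lies in a face that also contains the centroid, hence contains `s`. Since `c` is
positive at that point, it is positive at some vertex of this face. -/
lemma exists_insert_mem_faces (hT : T.faces.Finite) (hconv : Convex ℝ T.space)
    {s : Finset (ℝ × ℝ)} (hs : s ∈ T.faces) {c : ℝ × ℝ × ℝ} (hc : ∀ v ∈ s, affVal c v = 0)
    {x : ℝ × ℝ} (hx : x ∈ T.space) (hcx : 0 < affVal c x) :
    ∃ v, insert v s ∈ T.faces ∧ 0 < affVal c v := by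
  classical
  have hcard : (0 : ℝ) < s.card := by
    exact_mod_cast (nonempty_of_mem_faces hs).card_pos
  have hsum : ∑ _v ∈ s, (s.card : ℝ)⁻¹ = 1 := by simp [hcard.ne']
  set m : ℝ × ℝ := ∑ v ∈ s, (s.card : ℝ)⁻¹ • v with hm
  have hms : m ∈ convexHull ℝ (s : Set (ℝ × ℝ)) :=
    Finset.mem_convexHull'.2 ⟨fun _ => (s.card : ℝ)⁻¹, fun _ _ => by positivity, hsum, rfl⟩
  have hmT : m ∈ T.space := convexHull_subset_space hs hms
  have hcm : affVal c m = 0 := by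
    rw [hm, affVal_sum c (w := fun _ => (s.card : ℝ)⁻¹) hsum]
    exact Finset.sum_eq_zero fun v hv => by rw [hc v hv, mul_zero]
  have h1 : ∀ᶠ ε in nhdsWithin (0 : ℝ) (Set.Ioi 0), ∀ t ∈ T.faces,
      m ∉ convexHull ℝ (t : Set (ℝ × ℝ)) → m + ε • (x - m) ∉ convexHull ℝ (t : Set (ℝ × ℝ)) := by
    refine (Filter.eventually_all_finite hT).2 fun t _ => ?_
    by_cases hmt : m ∈ convexHull ℝ (t : Set (ℝ × ℝ))
    · exact Filter.Eventually.of_forall fun _ h => absurd hmt h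
    · have hcl : IsOpen (convexHull ℝ (t : Set (ℝ × ℝ)))ᶜ :=
        (t.finite_toSet.isClosed_convexHull (𝕜 := ℝ)).isOpen_compl
      have hcont : Continuous fun ε : ℝ => m + ε • (x - m) := by fun_prop
      have : ∀ᶠ ε in nhds (0 : ℝ), m + ε • (x - m) ∈ (convexHull ℝ (t : Set (ℝ × ℝ)))ᶜ :=
        hcont.continuousAt.eventually (hcl.mem_nhds (by simpa using hmt))
      exact (this.filter_mono nhdsWithin_le_nhds).mono fun ε h _ => h
  have h2 : ∀ᶠ ε in nhdsWithin (0 : ℝ) (Set.Ioi 0), 0 < ε ∧ ε < 1 :=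
    Ioo_mem_nhdsGT one_pos
  obtain ⟨ε, h1, hε0, hε1⟩ := (h1.and h2).exists
  have hmem : m + ε • (x - m) ∈ T.space :=
    hconv.add_smul_sub_mem hmT hx ⟨hε0.le, hε1.le⟩
  obtain ⟨t, ht, hxt⟩ := mem_space_iff.1 hmem
  have hmt : m ∈ convexHull ℝ (t : Set (ℝ × ℝ)) := by
    by_contra h
    exact h1 t ht h hxt
  have hst := subset_of_centroid_mem hs ht hmt
  have : ∃ v ∈ t, 0 < affVal c v := by
    by_contra! hneg
    have h0 : 0 ≤ affVal (-c) (m + ε • (x - m)) :=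
      affVal_nonneg_of_mem_convexHull (fun u hu => by
        have := hneg u hu
        simp [affVal] at this ⊢; linarith) hxt
    have h3 : affVal c (m + ε • (x - m)) = ε * affVal c x := by
      rw [affVal_add_smul, hcm]; ring
    have h4 : affVal (-c) (m + ε • (x - m)) = - affVal c (m + ε • (x - m)) := by
      simp [affVal]; ring
    have := mul_pos hε0 hcx
    linarith
  obtain ⟨v, hv, hcv⟩ := this
  exact ⟨v, T.down_closed ht (Finset.insert_subset hv hst) (Finset.insert_nonempty _ _), hcv⟩

/-- A complex is determined by any of its subsets of faces covering its space. -/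
lemma mem_faces_iff_of_cover {F : Set (Finset (ℝ × ℝ))} (hF : F ⊆ T.faces)
    (hcov : ∀ x ∈ T.space, ∃ σ ∈ F, x ∈ convexHull ℝ (σ : Set (ℝ × ℝ))) (s : Finset (ℝ × ℝ)) :
    s ∈ T.faces ↔ s.Nonempty ∧ ∃ σ ∈ F, s ⊆ σ := by
  refine ⟨fun hs => ⟨nonempty_of_mem_faces hs, ?_⟩, fun ⟨hne, σ, hσ, hsσ⟩ =>
    T.down_closed (hF hσ) hsσ hne⟩
  have hcard : (0 : ℝ) < s.card := by
    exact_mod_cast (nonempty_of_mem_faces hs).card_pos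
  have hms : ∑ v ∈ s, (s.card : ℝ)⁻¹ • v ∈ convexHull ℝ (s : Set (ℝ × ℝ)) :=
    Finset.mem_convexHull'.2
      ⟨fun _ => (s.card : ℝ)⁻¹, fun _ _ => by positivity, by simp [hcard.ne'], rfl⟩
  -- The cell that covers the centroid of `s` must contain all of `s`.
  obtain ⟨σ, hσ, hx⟩ := hcov _ (convexHull_subset_space hs hms)
  exact ⟨σ, hσ, subset_of_centroid_mem hs (hF hσ) hx⟩

end Geometry.SimplicialComplex

/-! ### Complexes cut out by heights -/

/-- The members of `F` are the vertex sets of lower faces of the lift of `V` to the heights `ω`,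
they are simplices, and they use all points of `V`. -/
structure IsLowerCells (V : Set (ℝ × ℝ)) (ω : ℝ × ℝ → ℝ) (F : Set (Finset (ℝ × ℝ))) : Prop where
  indep : ∀ σ ∈ F, AffineIndependent ℝ ((↑) : σ → ℝ × ℝ)
  subset : ∀ σ ∈ F, ∀ v ∈ σ, v ∈ V
  exists_mem : ∀ v ∈ V, ∃ σ ∈ F, v ∈ σ
  lower : ∀ σ ∈ F, ∃ c, ∀ v ∈ V, affVal c v ≤ ω v ∧ (affVal c v = ω v ↔ v ∈ σ)

namespace IsLowerCells

variable {V : Set (ℝ × ℝ)} {ω : ℝ × ℝ → ℝ} {F : Set (Finset (ℝ × ℝ))}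

/-- At a common point, `d` is at most the interpolation of `ω` over `σ`, which is `c`, and `c` is at
most the interpolation of `ω` over `s`, which is `d`. Equality holds throughout, so `c` touches `ω`
at every point of `s` with positive weight. -/
lemma mem_of_pos (h : IsLowerCells V ω F) {σ s : Finset (ℝ × ℝ)} (hσ : σ ∈ F)
    (hs : ∀ v ∈ s, v ∈ V) {d : ℝ × ℝ × ℝ} (hd : ∀ v ∈ V, affVal d v ≤ ω v)
    (hds : ∀ v ∈ s, affVal d v = ω v) {w : ℝ × ℝ → ℝ} (hw : ∀ v ∈ s, 0 ≤ w v)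
    (hw1 : ∑ v ∈ s, w v = 1) (hx : ∑ v ∈ s, w v • v ∈ convexHull ℝ (σ : Set (ℝ × ℝ)))
    {v : ℝ × ℝ} (hv : v ∈ s) (hwv : 0 < w v) : v ∈ σ := by
  obtain ⟨c, hc⟩ := h.lower σ hσ
  obtain ⟨b, hb0, hb1, hbx⟩ := Finset.mem_convexHull'.1 hx
  have h1 : affVal d (∑ v ∈ s, w v • v) ≤ affVal c (∑ v ∈ s, w v • v) := by
    rw [← hbx, affVal_sum d hb1, affVal_sum c hb1]
    refine Finset.sum_le_sum fun u hu => mul_le_mul_of_nonneg_left ?_ (hb0 u hu)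
    rw [((hc u (h.subset σ hσ u hu)).2).2 hu]
    exact hd u (h.subset σ hσ u hu)
  rw [affVal_sum d hw1, affVal_sum c hw1] at h1
  have h2 : ∀ u ∈ s, w u * affVal c u ≤ w u * affVal d u := fun u hu =>
    mul_le_mul_of_nonneg_left (by rw [hds u hu]; exact (hc u (hs u hu)).1) (hw u hu)
  have h3 := (Finset.sum_eq_sum_iff_of_le h2).1 (le_antisymm (Finset.sum_le_sum h2) h1) v hv
  have h4 := mul_left_cancel₀ hwv.ne' h3
  rw [hds v hv] at h4
  exact ((hc v (hs v hv)).2).1 h4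

/-- The simplicial complex of the nonempty subsets of cells. -/
def complex (h : IsLowerCells V ω F) : SimplicialComplex ℝ (ℝ × ℝ) where
  faces := {s | s.Nonempty ∧ ∃ σ ∈ F, s ⊆ σ}
  isRelLowerSet_faces := by
    rintro s ⟨hs, σ, hσ, hsσ⟩
    exact ⟨hs, fun t hts ht => ⟨ht, σ, hσ, hts.trans hsσ⟩⟩
  indep := by
    rintro s ⟨-, σ, hσ, hsσ⟩
    exact (h.indep σ hσ).mono hsσ
  inter_subset_convexHull := by
    classical
    rintro s t ⟨-, σ, hσ, hsσ⟩ ⟨-, τ, hτ, htτ⟩ x ⟨hxs, hxt⟩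
    obtain ⟨w, hw0, hw1, rfl⟩ := Finset.mem_convexHull'.1 hxs
    obtain ⟨c, hc⟩ := h.lower σ hσ
    -- The support of the point in `s` lies in `τ`. This support and `t` are then faces of the
    -- single simplex `τ`, where the intersection property is known.
    have hpos : ∀ v ∈ s, 0 < w v → v ∈ τ := fun v hv hwv =>
      h.mem_of_pos hτ (fun u hu => h.subset σ hσ u (hsσ hu)) (fun u hu => (hc u hu).1)
        (fun u hu => ((hc u (h.subset σ hσ u (hsσ hu))).2).2 (hsσ hu)) hw0 hw1
        (convexHull_mono (by exact_mod_cast htτ) hxt) hv hwv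
    have hx : ∑ v ∈ s, w v • v ∈
        convexHull ℝ ((s.filter fun v => 0 < w v : Finset (ℝ × ℝ)) : Set (ℝ × ℝ)) := by
      have hz : ∀ v ∈ s, v ∉ s.filter (fun v => 0 < w v) → w v = 0 := fun v hv hv' =>
        le_antisymm (not_lt.1 fun h0 => hv' (Finset.mem_filter.2 ⟨hv, h0⟩)) (hw0 v hv)
      refine Finset.mem_convexHull'.2 ⟨w, fun v hv => hw0 v (Finset.mem_filter.1 hv).1, ?_, ?_⟩
      · rw [← hw1]
        exact Finset.sum_subset (Finset.filter_subset _ _) hz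
      · exact Finset.sum_subset (Finset.filter_subset _ _) fun v hv hv' => by
          rw [hz v hv hv', zero_smul]
    have hsub : s.filter (fun v => 0 < w v) ⊆ τ := fun v hv =>
      hpos v (Finset.mem_filter.1 hv).1 (Finset.mem_filter.1 hv).2
    have hxi := ((h.indep τ hτ).convexHull_inter hsub htτ).symm.subset ⟨hx, hxt⟩
    refine convexHull_mono ?_ hxi
    intro v hv
    simp only [Finset.coe_filter, Set.mem_inter_iff, Set.mem_ofPred_eq,
      Finset.mem_coe] at hv ⊢
    exact ⟨hv.1.1, hv.2⟩

lemma subset_complex_faces (h : IsLowerCells V ω F) (hne : ∀ σ ∈ F, σ.Nonempty) :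
    F ⊆ h.complex.faces := fun σ hσ => ⟨hne σ hσ, σ, hσ, subset_rfl⟩

lemma isFineTriangulation_complex {P : Set (ℝ × ℝ)} (hP : Convex ℝ P)
    (h : IsLowerCells (latticePoints P) ω F) (hne : ∀ σ ∈ F, σ.Nonempty)
    (hcov : ∀ x ∈ P, ∃ σ ∈ F, x ∈ convexHull ℝ (σ : Set (ℝ × ℝ))) :
    IsFineTriangulation P h.complex := by
  refine ⟨⟨?_, ?_⟩, ?_⟩
  · ext x
    rw [SimplicialComplex.mem_space_iff]
    constructor
    · rintro ⟨s, ⟨-, σ, hσ, hsσ⟩, hx⟩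
      exact convexHull_min (fun v hv => (h.subset σ hσ v (hsσ hv)).1) hP hx
    · intro hx
      obtain ⟨σ, hσ, hx⟩ := hcov x hx
      exact ⟨σ, h.subset_complex_faces hne hσ, hx⟩
  · rintro v ⟨-, σ, hσ, hv⟩
    exact h.subset σ hσ v (hv (Finset.mem_singleton_self v))
  · intro v hv
    obtain ⟨σ, hσ, hvσ⟩ := h.exists_mem v hv
    exact ⟨Finset.singleton_nonempty v, σ, hσ, Finset.singleton_subset_iff.2 hvσ⟩

end IsLowerCells

/-! ### Lower faces of the lifted polytope -/

section LowerFaces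

variable {P : Set (ℝ × ℝ)} {V : Finset (ℝ × ℝ)} {ω : ℝ × ℝ → ℝ}

lemma mem_liftedPolytope_iff (hV : latticePoints P = V) {q : (ℝ × ℝ) × ℝ} :
    q ∈ liftedPolytope P ω ↔ ∃ w : ℝ × ℝ → ℝ, (∀ v ∈ V, 0 ≤ w v) ∧ ∑ v ∈ V, w v = 1 ∧
      ∑ v ∈ V, w v • v = q.1 ∧ ∑ v ∈ V, w v * ω v = q.2 := by
  classical
  have hinj : Function.Injective fun p : ℝ × ℝ => (p, ω p) := fun p q h => (Prod.ext_iff.1 h).1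
  have : (fun p => (p, ω p)) '' latticePoints P =
      ((V.image fun p => (p, ω p) : Finset ((ℝ × ℝ) × ℝ)) : Set ((ℝ × ℝ) × ℝ)) := by
    rw [hV, Finset.coe_image]
  rw [liftedPolytope, this, Finset.mem_convexHull']
  simp only [Finset.sum_image hinj.injOn, Finset.forall_mem_image]
  constructor
  · rintro ⟨w, hw0, hw1, rfl⟩
    exact ⟨fun v => w (v, ω v), hw0, hw1, by simp [Prod.fst_sum], by simp [Prod.snd_sum]⟩
  · rintro ⟨w, hw0, hw1, h1, h2⟩
    refine ⟨fun q => w q.1, hw0, hw1, ?_⟩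
    ext <;> simp [Prod.fst_sum, Prod.snd_sum, ← h1, ← h2]

lemma linear_add_eq_sum (l : (ℝ × ℝ) →ₗ[ℝ] ℝ) {w : ℝ × ℝ → ℝ} {q : (ℝ × ℝ) × ℝ}
    (h1 : ∑ v ∈ V, w v • v = q.1) (h2 : ∑ v ∈ V, w v * ω v = q.2) :
    l q.1 + q.2 = ∑ v ∈ V, w v * (l v + ω v) := by
  rw [← h1, ← h2, map_sum, ← Finset.sum_add_distrib]
  exact Finset.sum_congr rfl fun v _ => by rw [map_smul, smul_eq_mul]; ring

lemma mem_liftedPolytope_of_mem (hV : latticePoints P = V) {v : ℝ × ℝ} (hv : v ∈ V) :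
    (v, ω v) ∈ liftedPolytope P ω :=
  subset_convexHull ℝ _ ⟨v, by rw [hV]; exact hv, rfl⟩

/-- The value at a convex combination of lifted points is the weighted mean of their values, so it
equals the minimum `m` only if all the weight sits on points with value `m`. -/
lemma fst_image_minimizers (hV : latticePoints P = V) (l : (ℝ × ℝ) →ₗ[ℝ] ℝ) {m : ℝ}
    (hm : ∀ v ∈ V, m ≤ l v + ω v) {s : Finset (ℝ × ℝ)} (hs : s.Nonempty)
    (hsV : ∀ v, v ∈ s ↔ v ∈ V ∧ l v + ω v = m) :
    Prod.fst '' {q | q ∈ liftedPolytope P ω ∧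
      ∀ q' ∈ liftedPolytope P ω, l q.1 + q.2 ≤ l q'.1 + q'.2} =
      convexHull ℝ (s : Set (ℝ × ℝ)) := by
  classical
  have hle : ∀ q ∈ liftedPolytope P ω, m ≤ l q.1 + q.2 := by
    intro q hq
    obtain ⟨w, hw0, hw1, h1, h2⟩ := (mem_liftedPolytope_iff hV).1 hq
    rw [linear_add_eq_sum l h1 h2, ← one_mul m, ← hw1, Finset.sum_mul]
    exact Finset.sum_le_sum fun v hv => mul_le_mul_of_nonneg_left (hm v hv) (hw0 v hv)
  have hsub : s ⊆ V := fun v hv => ((hsV v).1 hv).1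
  ext x
  rw [Finset.mem_convexHull']
  constructor
  · rintro ⟨q, ⟨hq, hmin⟩, rfl⟩
    obtain ⟨w, hw0, hw1, h1, h2⟩ := (mem_liftedPolytope_iff hV).1 hq
    obtain ⟨u, hu⟩ := hs
    have hu' := (hsV u).1 hu
    have hqm : l q.1 + q.2 = m :=
      le_antisymm (by rw [← hu'.2]; exact hmin _ (mem_liftedPolytope_of_mem hV hu'.1)) (hle q hq)
    rw [linear_add_eq_sum l h1 h2] at hqm
    have hms : ∑ v ∈ V, w v * m = ∑ v ∈ V, w v * (l v + ω v) := by
      rw [hqm, ← Finset.sum_mul, hw1, one_mul]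
    have heq := (Finset.sum_eq_sum_iff_of_le
      fun v hv => mul_le_mul_of_nonneg_left (hm v hv) (hw0 v hv)).1 hms
    have hz : ∀ v ∈ V, v ∉ s → w v = 0 := by
      intro v hv hvs
      by_contra h0
      exact hvs ((hsV v).2 ⟨hv, (mul_left_cancel₀ h0 (heq v hv)).symm⟩)
    refine ⟨w, fun v hv => hw0 v (hsub hv), ?_, ?_⟩
    · rw [← hw1]
      exact Finset.sum_subset hsub hz
    · rw [← h1]
      exact Finset.sum_subset hsub fun v hv hv' => by rw [hz v hv hv', zero_smul]
  · rintro ⟨w, hw0, hw1, rfl⟩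
    have hsum : ∀ {M : Type} [AddCommMonoid M] (g : ℝ × ℝ → M),
        ∑ v ∈ V, (if v ∈ s then g v else 0) = ∑ v ∈ s, g v := by
      intro M _ g
      rw [← Finset.sum_filter]
      congr 1
      ext v
      simp only [Finset.mem_filter]
      exact ⟨fun h => h.2, fun h => ⟨hsub h, h⟩⟩
    have hq : (∑ v ∈ s, w v • v, ∑ v ∈ s, w v * ω v) ∈ liftedPolytope P ω := by
      rw [mem_liftedPolytope_iff hV]
      refine ⟨fun v => if v ∈ s then w v else 0, fun v _ => ?_, ?_, ?_, ?_⟩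
      · dsimp only
        split_ifs with h
        · exact hw0 v h
        · exact le_rfl
      · rw [← hw1]; exact hsum w
      · simp only [ite_smul, zero_smul]; exact hsum fun v => w v • v
      · simp only [ite_mul, zero_mul]; exact hsum fun v => w v * ω v
    refine ⟨_, ⟨hq, fun q' hq' => le_trans (le_of_eq ?_) (hle q' hq')⟩, rfl⟩
    rw [linear_add_eq_sum (V := s) l rfl rfl, ← one_mul m, ← hw1, Finset.sum_mul]
    exact Finset.sum_congr rfl fun v hv => by rw [((hsV v).1 hv).2]

/-- A nonempty subset of a cell is cut out by tilting the supporting plane of the cell. Conversely,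
the vertices of a lower face all belong to the cell covering their centroid, by `mem_of_pos`. -/
lemma IsLowerCells.isRegularTriangulation_complex {F : Set (Finset (ℝ × ℝ))}
    (hV : latticePoints P = V) (h : IsLowerCells (latticePoints P) ω F)
    (hcov : ∀ x ∈ convexHull ℝ (latticePoints P),
      ∃ σ ∈ F, x ∈ convexHull ℝ (σ : Set (ℝ × ℝ))) :
    IsRegularTriangulation P h.complex := by
  classical
  refine ⟨ω, Set.Subset.antisymm ?_ ?_⟩
  · rintro S ⟨s, ⟨hs, σ, hσ, hsσ⟩, rfl⟩
    obtain ⟨c, hc⟩ := h.lower σ hσ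
    obtain ⟨e, he0, he1⟩ := (h.indep σ hσ).exists_affVal (s : Set (ℝ × ℝ))
    rw [hV] at hc
    have hσV : ∀ v ∈ σ, v ∈ V := fun v hv => by
      have := h.subset σ hσ v hv
      rwa [hV] at this
    -- Subtracting `ε * e` from the plane releases the vertices of `σ` outside `s` and keeps those
    -- of `s`. For small `ε` the finitely many points off `σ` stay strictly above.
    have hev : ∀ᶠ ε in nhdsWithin (0 : ℝ) (Set.Ioi 0), ∀ v ∈ V, v ∉ σ →
        0 < ω v - affVal c v + ε * affVal e v := by
      refine (Filter.eventually_all_finset V).2 fun v hv => ?_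
      by_cases hvσ : v ∈ σ
      · exact Filter.Eventually.of_forall fun _ h => absurd hvσ h
      · have hlt : 0 < ω v - affVal c v + 0 * affVal e v := by
          have := lt_of_le_of_ne (hc v hv).1 fun h => hvσ ((hc v hv).2.1 h)
          linarith
        have hcont : Continuous fun ε : ℝ => ω v - affVal c v + ε * affVal e v := by fun_prop
        exact ((hcont.continuousAt.eventually (lt_mem_nhds hlt)).filter_mono
          nhdsWithin_le_nhds).mono fun ε h _ => h
    obtain ⟨ε, hε, hε0⟩ := (hev.and self_mem_nhdsWithin).exists
    replace hε0 : 0 < ε := hε0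
    let l : (ℝ × ℝ) →ₗ[ℝ] ℝ :=
      (ε * e.2.1 - c.2.1) • LinearMap.fst ℝ ℝ ℝ + (ε * e.2.2 - c.2.2) • LinearMap.snd ℝ ℝ ℝ
    have hl : ∀ v, l v + ω v = ω v - affVal c v + ε * affVal e v + (c.1 - ε * e.1) := by
      intro v
      simp [l, affVal]; ring
    have key : ∀ v ∈ V, 0 ≤ ω v - affVal c v + ε * affVal e v ∧
        (ω v - affVal c v + ε * affVal e v = 0 ↔ v ∈ s) := by
      intro v hv
      by_cases hvσ : v ∈ σ
      · rw [((hc v hv).2).2 hvσ]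
        by_cases hvs : v ∈ s
        · rw [he0 v hvσ hvs]; simp [hvs]
        · rw [he1 v hvσ hvs]
          refine ⟨by linarith, iff_of_false ?_ hvs⟩
          linarith
      · exact ⟨(hε v hv hvσ).le, iff_of_false (hε v hv hvσ).ne' fun h => hvσ (hsσ h)⟩
    have himg := fst_image_minimizers hV l (m := c.1 - ε * e.1)
      (fun v hv => by rw [hl]; linarith [(key v hv).1]) hs (fun v => by
        rw [hl]
        constructor
        · intro hv
          exact ⟨hσV v (hsσ hv), by rw [((key v (hσV v (hsσ hv))).2).2 hv]; ring⟩
        · rintro ⟨hv, h⟩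
          exact ((key v hv).2).1 (by linarith))
    refine ⟨_, ⟨?_, l, rfl⟩, himg.symm⟩
    rw [← Set.image_nonempty (f := Prod.fst), himg, convexHull_nonempty_iff]
    exact_mod_cast hs
  · rintro S ⟨F', ⟨⟨q, hq⟩, l, rfl⟩, rfl⟩
    set m := l q.1 + q.2 with hmdef
    have hm : ∀ v ∈ V, m ≤ l v + ω v := fun v hv =>
      hq.2 _ (mem_liftedPolytope_of_mem hV hv)
    set s := V.filter fun v => l v + ω v = m with hsdef
    have hsV : ∀ v, v ∈ s ↔ v ∈ V ∧ l v + ω v = m := fun v => by simp [hsdef]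
    have hs : s.Nonempty := by
      by_contra hne
      obtain ⟨w, hw0, hw1, h1, h2⟩ := (mem_liftedPolytope_iff hV).1 hq.1
      have hms : ∑ v ∈ V, w v * m = ∑ v ∈ V, w v * (l v + ω v) := by
        rw [← linear_add_eq_sum l h1 h2, ← Finset.sum_mul, hw1, one_mul]
      have heq := (Finset.sum_eq_sum_iff_of_le
        fun v hv => mul_le_mul_of_nonneg_left (hm v hv) (hw0 v hv)).1 hms
      have : ∑ v ∈ V, w v = 0 := Finset.sum_eq_zero fun v hv => by
        by_contra h0
        exact hne ⟨v, (hsV v).2 ⟨hv, (mul_left_cancel₀ h0 (heq v hv)).symm⟩⟩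
      rw [hw1] at this
      exact one_ne_zero this
    rw [fst_image_minimizers hV l hm hs hsV]
    refine ⟨s, ⟨hs, ?_⟩, rfl⟩
    have hcard : (0 : ℝ) < s.card := by exact_mod_cast hs.card_pos
    have hsub : ∀ v ∈ s, v ∈ latticePoints P := fun v hv => by
      rw [hV]; exact ((hsV v).1 hv).1
    have hw1 : ∑ _v ∈ s, (s.card : ℝ)⁻¹ = 1 := by simp [hcard.ne']
    have hx : ∑ v ∈ s, (s.card : ℝ)⁻¹ • v ∈ convexHull ℝ (s : Set (ℝ × ℝ)) :=
      Finset.mem_convexHull'.2 ⟨fun _ => (s.card : ℝ)⁻¹, fun _ _ => by positivity, hw1, rfl⟩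
    obtain ⟨σ, hσ, hxσ⟩ := hcov _ (convexHull_mono hsub hx)
    -- Minimality of `m` says that the affine function `m - l` lies below `ω` and touches it exactly
    -- on `s`.
    have hlin : ∀ v : ℝ × ℝ, affVal (m, -l (1, 0), -l (0, 1)) v = m - l v := by
      intro v
      have h2 : v = v.1 • ((1 : ℝ), (0 : ℝ)) + v.2 • ((0 : ℝ), (1 : ℝ)) := by
        ext <;> simp
      conv_rhs => rw [h2, map_add, map_smul, map_smul]
      simp [affVal]; ring
    refine ⟨σ, hσ, fun v hv => h.mem_of_pos hσ hsub (d := (m, -l (1, 0), -l (0, 1)))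
      (fun u hu => ?_) (fun u hu => ?_) (w := fun _ => (s.card : ℝ)⁻¹)
      (fun _ _ => by positivity) hw1 hxσ hv (by positivity)⟩
    · rw [hlin]
      rw [hV] at hu
      linarith [hm u hu]
    · rw [hlin]
      linarith [((hsV u).1 hu).2]

end LowerFaces

/-! ### Columns and the kinds of cells -/

/-- The point at height `i` of the column with abscissa `u`. -/
def pt (u : ℝ) (i : ℕ) : ℝ × ℝ := (u, i)

@[simp] lemma pt_inj {u w : ℝ} {i j : ℕ} : pt u i = pt w j ↔ u = w ∧ i = j := by
  simp [pt]

@[simp] lemma pt_fst (u : ℝ) (i : ℕ) : (pt u i).1 = u := rfl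

@[simp] lemma pt_snd (u : ℝ) (i : ℕ) : (pt u i).2 = i := rfl

/-- The lattice points on or below the polygonal line through `(0, a)`, `(1, c)`, `(2, b)`. -/
def frontPts (a c b : ℕ) : Set (ℝ × ℝ) :=
  {v | (∃ i ≤ a, v = pt 0 i) ∨ (∃ i ≤ c, v = pt 1 i) ∨ ∃ i ≤ b, v = pt 2 i}

lemma pt_zero_mem_frontPts {a c b i : ℕ} : pt 0 i ∈ frontPts a c b ↔ i ≤ a := by
  simp [frontPts]

lemma pt_one_mem_frontPts {a c b i : ℕ} : pt 1 i ∈ frontPts a c b ↔ i ≤ c := by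
  simp [frontPts]

lemma pt_two_mem_frontPts {a c b i : ℕ} : pt 2 i ∈ frontPts a c b ↔ i ≤ b := by
  simp [frontPts]

lemma frontPts_mono {a c b a' c' b' : ℕ} (ha : a ≤ a') (hc : c ≤ c') (hb : b ≤ b') :
    frontPts a c b ⊆ frontPts a' c' b' := by
  rintro v (⟨i, hi, rfl⟩ | ⟨i, hi, rfl⟩ | ⟨i, hi, rfl⟩)
  · exact pt_zero_mem_frontPts.2 (hi.trans ha)
  · exact pt_one_mem_frontPts.2 (hi.trans hc)
  · exact pt_two_mem_frontPts.2 (hi.trans hb)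

/-- The triangle with a unit edge in the column `u` and apex `(1, c)`. -/
noncomputable def sideTri (u : ℝ) (a c : ℕ) : Finset (ℝ × ℝ) := {pt u a, pt u (a + 1), pt 1 c}

/-- The triangle with a unit edge in the middle column and apex in the column `u`. -/
noncomputable def midTri (u : ℝ) (a c : ℕ) : Finset (ℝ × ℝ) := {pt u a, pt 1 c, pt 1 (c + 1)}

/-- The triangle with an edge from `(0, a)` to `(2, b)` and apex `(1, c)`. -/
noncomputable def crossTri (a b c : ℕ) : Finset (ℝ × ℝ) := {pt 0 a, pt 2 b, pt 1 c}

lemma affineIndependent_sideTri {u : ℝ} (hu : u ≠ 1) (a c : ℕ) :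
    AffineIndependent ℝ ((↑) : sideTri u a c → ℝ × ℝ) := by
  have hu' : u - 1 ≠ 0 := sub_ne_zero.2 hu
  refine affineIndependent_of_affVal fun v hv => ?_
  simp only [sideTri, Finset.mem_insert, Finset.mem_singleton] at hv
  simp only [sideTri, Finset.mem_insert, Finset.mem_singleton, forall_eq_or_imp, forall_eq]
  rcases hv with rfl | rfl | rfl
  · refine ⟨((u - 1) * (a + 1) + u * (c - a - 1), -(c - a - 1), -(u - 1)), ?_, ?_, ?_, ?_⟩
    · have : affVal ((u - 1) * (a + 1) + u * (c - a - 1), -(c - a - 1), -(u - 1)) (pt u a)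
          = u - 1 := by simp [affVal, pt]; ring
      rwa [this]
    · simp
    · intro _; simp [affVal, pt]; ring
    · intro _; simp [affVal, pt]; ring
  · refine ⟨((u - 1) * a + u * (c - a), -(c - a), -(u - 1)), ?_, ?_, ?_, ?_⟩
    · have : affVal ((u - 1) * a + u * (c - a), -(c - a), -(u - 1)) (pt u (a + 1))
          = -(u - 1) := by simp [affVal, pt]; ring
      rw [this]; exact neg_ne_zero.2 hu'
    · intro _; simp [affVal, pt]; ring
    · simp
    · intro _; simp [affVal, pt]; ring
  · refine ⟨(u, -1, 0), ?_, ?_, ?_, ?_⟩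
    · have : affVal (u, -1, 0) (pt 1 c) = u - 1 := by simp [affVal, pt]; ring
      rwa [this]
    · intro _; simp [affVal, pt]
    · intro _; simp [affVal, pt]
    · simp

lemma affineIndependent_midTri {u : ℝ} (hu : u ≠ 1) (a c : ℕ) :
    AffineIndependent ℝ ((↑) : midTri u a c → ℝ × ℝ) := by
  have hu' : u - 1 ≠ 0 := sub_ne_zero.2 hu
  refine affineIndependent_of_affVal fun v hv => ?_
  simp only [midTri, Finset.mem_insert, Finset.mem_singleton] at hv
  simp only [midTri, Finset.mem_insert, Finset.mem_singleton, forall_eq_or_imp, forall_eq]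
  rcases hv with rfl | rfl | rfl
  · refine ⟨(1, -1, 0), ?_, ?_, ?_, ?_⟩
    · have : affVal (1, -1, 0) (pt u a) = -(u - 1) := by simp [affVal, pt]; ring
      rw [this]; exact neg_ne_zero.2 hu'
    · simp
    · intro _; simp [affVal, pt]
    · intro _; simp [affVal, pt]
  · refine ⟨((u - 1) * a - u * (a - (c + 1)), a - (c + 1), -(u - 1)), ?_, ?_, ?_, ?_⟩
    · have : affVal ((u - 1) * a - u * (a - (c + 1)), a - (c + 1), -(u - 1)) (pt 1 c)
          = u - 1 := by simp [affVal, pt]; ring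
      rwa [this]
    · intro _; simp [affVal, pt]; ring
    · simp
    · intro _; simp [affVal, pt]; ring
  · refine ⟨((u - 1) * a - u * (a - c), a - c, -(u - 1)), ?_, ?_, ?_, ?_⟩
    · have : affVal ((u - 1) * a - u * (a - c), a - c, -(u - 1)) (pt 1 (c + 1))
          = -(u - 1) := by simp [affVal, pt]; ring
      rw [this]; exact neg_ne_zero.2 hu'
    · intro _; simp [affVal, pt]; ring
    · intro _; simp [affVal, pt]; ring
    · simp

lemma affineIndependent_crossTri {a b c : ℕ} (h : a + b ≠ 2 * c) :
    AffineIndependent ℝ ((↑) : crossTri a b c → ℝ × ℝ) := by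
  have h' : (a : ℝ) + b - 2 * c ≠ 0 := by
    rw [sub_ne_zero]; exact_mod_cast h
  refine affineIndependent_of_affVal fun v hv => ?_
  simp only [crossTri, Finset.mem_insert, Finset.mem_singleton] at hv
  simp only [crossTri, Finset.mem_insert, Finset.mem_singleton, forall_eq_or_imp, forall_eq]
  rcases hv with rfl | rfl | rfl
  · refine ⟨(b - 2 * (b - c), b - c, -1), ?_, ?_, ?_, ?_⟩
    · have : affVal (b - 2 * (b - c), b - c, -1) (pt 0 a) = -((a : ℝ) + b - 2 * c) := by
        simp [affVal, pt]; ring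
      rw [this]; exact neg_ne_zero.2 h'
    · simp
    · intro _; simp [affVal, pt]; ring
    · intro _; simp [affVal, pt]; ring
  · refine ⟨(a, c - a, -1), ?_, ?_, ?_, ?_⟩
    · have : affVal (a, c - a, -1) (pt 2 b) = -((a : ℝ) + b - 2 * c) := by
        simp [affVal, pt]; ring
      rw [this]; exact neg_ne_zero.2 h'
    · intro _; simp [affVal, pt]
    · simp
    · intro _; simp [affVal, pt]
  · refine ⟨(2 * a, b - a, -2), ?_, ?_, ?_, ?_⟩
    · have : affVal (2 * a, b - a, -2) (pt 1 c) = (a : ℝ) + b - 2 * c := by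
        simp [affVal, pt]; ring
      rwa [this]
    · intro _; simp [affVal, pt]
    · intro _; simp [affVal, pt]; ring
    · simp

lemma affineIndependent_bottomEdge {u : ℝ} (hu : u ≠ 1) :
    AffineIndependent ℝ ((↑) : ({pt u 0, pt 1 0} : Finset (ℝ × ℝ)) → ℝ × ℝ) :=
  (affineIndependent_midTri hu 0 0).mono (t := midTri u 0 0) (by
    intro v hv
    simp only [midTri, Finset.coe_insert, Finset.coe_singleton, Set.mem_insert_iff,
      Set.mem_singleton_iff] at hv ⊢
    tauto)

lemma Convex.triple_mem {S : Set (ℝ × ℝ)} (hS : Convex ℝ S) {p q r : ℝ × ℝ} (hp : p ∈ S)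
    (hq : q ∈ S) (hr : r ∈ S) {x y z : ℝ} (hx : 0 ≤ x) (hy : 0 ≤ y) (hz : 0 ≤ z)
    (h : x + y + z = 1) {v : ℝ × ℝ} (h1 : v.1 = x * p.1 + y * q.1 + z * r.1)
    (h2 : v.2 = x * p.2 + y * q.2 + z * r.2) : v ∈ S := by
  have := hS.sum_mem (t := Finset.univ) (w := ![x, y, z]) (z := ![p, q, r])
    (by intro i _; fin_cases i <;> simpa) (by simpa [Fin.sum_univ_three] using h)
    (by intro i _; fin_cases i <;> simpa)
  convert! this using 1
  ext <;> simp [Fin.sum_univ_three, h1, h2]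

lemma mem_of_between_side {S : Set (ℝ × ℝ)} (hS : Convex ℝ S) {u : ℝ} {a c : ℕ}
    (h1 : pt u a ∈ S) (h2 : pt u (a + 1) ∈ S) (h3 : pt 1 c ∈ S) {x y : ℝ} (hx0 : 0 ≤ x)
    (hl : a + (c - a) * x ≤ y) (hr : y ≤ (a + 1 : ℕ) + (c - (a + 1 : ℕ)) * x) :
    (u + (1 - u) * x, y) ∈ S := by
  push_cast at hr
  refine hS.triple_mem h1 h2 h3 (x := 1 - x - (y - (a + (c - a) * x)))
    (y := y - (a + (c - a) * x)) (z := x) (by linarith) (by linarith) hx0 (by ring) ?_ ?_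
  · simp; ring
  · simp; ring

lemma mem_of_between_mid {S : Set (ℝ × ℝ)} (hS : Convex ℝ S) {u : ℝ} {a c : ℕ}
    (h1 : pt u a ∈ S) (h2 : pt 1 c ∈ S) (h3 : pt 1 (c + 1) ∈ S) {x y : ℝ} (hx1 : x ≤ 1)
    (hl : a + (c - a) * x ≤ y) (hr : y ≤ a + ((c + 1 : ℕ) - a) * x) :
    (u + (1 - u) * x, y) ∈ S := by
  push_cast at hr
  refine hS.triple_mem h1 h2 h3 (x := 1 - x) (y := x - (y - (a + (c - a) * x)))
    (z := y - (a + (c - a) * x)) (by linarith) (by linarith) (by linarith) (by ring) ?_ ?_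
  · simp; ring
  · simp; ring

lemma mem_of_below_cross {S : Set (ℝ × ℝ)} (hS : Convex ℝ S) {u : ℝ} {a b c : ℕ}
    (hab : a + b = 2 * c + 1) (h1 : pt u a ∈ S) (h2 : pt (2 - u) b ∈ S) (h3 : pt 1 c ∈ S)
    {x y : ℝ} (hx1 : x ≤ 1) (hl : a + (c - a) * x ≤ y)
    (hr : y ≤ a + ((a + b) / 2 - a) * x) : (u + (1 - u) * x, y) ∈ S := by
  have hab' : (a : ℝ) + b = 2 * c + 1 := by exact_mod_cast hab
  have hc : (c : ℝ) = (a + b - 1) / 2 := by linarith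
  rw [hc] at hl
  -- The apex lies 1/2 below the midpoint of the long edge, so its weight is twice the depth of the
  -- point below that edge.
  set w := 2 * (a + ((a + b) / 2 - a) * x - y) with hw
  refine hS.triple_mem h1 h2 h3 (x := 1 - w - (x - w) / 2) (y := (x - w) / 2) (z := w)
    (by linarith) (by linarith) (by linarith) (by ring) ?_ ?_
  · simp; ring
  · simp [hc, hw]; ring

lemma mem_of_above_cross {S : Set (ℝ × ℝ)} (hS : Convex ℝ S) {u : ℝ} {a b c : ℕ}
    (hab : a + b = 2 * c + 1) (h1 : pt u a ∈ S) (h2 : pt (2 - u) b ∈ S) (h3 : pt 1 (c + 1) ∈ S)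
    {x y : ℝ} (hx1 : x ≤ 1) (hl : a + ((a + b) / 2 - a) * x ≤ y)
    (hr : y ≤ a + ((c + 1 : ℕ) - a) * x) : (u + (1 - u) * x, y) ∈ S := by
  have hab' : (a : ℝ) + b = 2 * c + 1 := by exact_mod_cast hab
  have hc : (c : ℝ) = (a + b - 1) / 2 := by linarith
  push_cast at hr
  rw [hc] at hr
  set w := 2 * (y - (a + ((a + b) / 2 - a) * x)) with hw
  refine hS.triple_mem h1 h2 h3 (x := 1 - w - (x - w) / 2) (y := (x - w) / 2) (z := w)
    (by linarith) (by linarith) (by linarith) (by ring) ?_ ?_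
  · simp; ring
  · simp [hc, hw]; ring

/-! ### Heights extended one cell at a time -/

/-- On the column with heights `f` the function `p + q * i` lies weakly below the heights, with
equality exactly on `m`. -/
def ColAt (a : ℕ) (f : ℕ → ℝ) (p q : ℝ) (m : ℕ → Prop) : Prop :=
  ∀ i ≤ a, p + q * i ≤ f i ∧ (p + q * i = f i ↔ m i)

/-- The line of slope `s` through the last point of the column lies strictly below the others. -/
def ColSupport (a : ℕ) (f : ℕ → ℝ) (s : ℝ) : Prop :=
  ∀ i < a, f a + s * ((i : ℝ) - a) < f i

lemma ColSupport.mono {a : ℕ} {f : ℕ → ℝ} {s s' : ℝ} (h : ColSupport a f s) (hs : s ≤ s') :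
    ColSupport a f s' := by
  intro i hi
  have h1 := h i hi
  have h2 : (i : ℝ) < a := by exact_mod_cast hi
  nlinarith [mul_nonneg (sub_nonneg.2 hs) (sub_pos.2 h2).le]

lemma ColSupport.update {a : ℕ} {f : ℕ → ℝ} {s s' h : ℝ} (hf : ColSupport a f s) (hs : s ≤ s')
    (hh : h < f a + s') : ColSupport (a + 1) (Function.update f (a + 1) h) s' := by
  intro i hi
  have hne : i ≠ a + 1 := hi.ne
  rw [Function.update_self, Function.update_of_ne hne]
  push_cast
  rcases (Nat.lt_succ_iff.1 hi).eq_or_lt with rfl | hlt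
  · linarith
  · have := hf.mono hs i hlt
    linarith

lemma ColSupport.colAt {a : ℕ} {f : ℕ → ℝ} {s p : ℝ} {m : ℕ → Prop} (hf : ColSupport a f s)
    (hp : p = f a - s * a) (hm : ∀ i, m i ↔ i = a) : ColAt a f p s m := by
  intro i hi
  rw [hm, hp]
  rcases hi.eq_or_lt with rfl | hlt
  · exact ⟨by linarith, by simp⟩
  · have := hf i hlt
    exact ⟨by linarith, iff_of_false (by intro h; linarith) hlt.ne⟩

lemma ColSupport.colAt_of_lt {a : ℕ} {f : ℕ → ℝ} {s p : ℝ} {m : ℕ → Prop} (hf : ColSupport a f s)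
    (hp : p < f a - s * a) (hm : ∀ i, ¬ m i) : ColAt a f p s m := by
  intro i hi
  have : p + s * i < f i := by
    rcases hi.eq_or_lt with rfl | hlt
    · linarith
    · have := hf i hlt
      linarith
  exact ⟨this.le, iff_of_false this.ne (hm i)⟩

lemma ColSupport.colAt_update {a : ℕ} {f : ℕ → ℝ} {s p h : ℝ} {m : ℕ → Prop}
    (hf : ColSupport a f s) (hp : p = f a - s * a) (hh : h = f a + s)
    (hm : ∀ i, m i ↔ i = a ∨ i = a + 1) : ColAt (a + 1) (Function.update f (a + 1) h) p s m := by
  intro i hi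
  rw [hm]
  rcases hi.eq_or_lt with rfl | hlt
  · rw [Function.update_self, hh, hp]
    push_cast
    exact ⟨by linarith, iff_of_true (by ring) (Or.inr rfl)⟩
  · rw [Function.update_of_ne hlt.ne]
    have := hf.colAt hp (m := fun i => i = a) (fun _ => Iff.rfl) i (Nat.lt_succ_iff.1 hlt)
    refine ⟨this.1, this.2.trans ?_⟩
    have : i ≠ a + 1 := hlt.ne
    tauto

lemma ColAt.update {a : ℕ} {f : ℕ → ℝ} {p q h : ℝ} {m : ℕ → Prop} (hf : ColAt a f p q m)
    (hh : f a + q < h) (hm : ¬ m (a + 1)) :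
    ColAt (a + 1) (Function.update f (a + 1) h) p q m := by
  intro i hi
  rcases hi.eq_or_lt with rfl | hlt
  · have := (hf a le_rfl).1
    rw [Function.update_self]
    push_cast
    exact ⟨by linarith, iff_of_false (by intro h; linarith) hm⟩
  · rw [Function.update_of_ne hlt.ne]
    exact hf i (Nat.lt_succ_iff.1 hlt)

/-- An affine function of slope less than `s` in the second variable lies below the heights
`f₀`, `f₁`, `f₂` on the three columns, with equality exactly at `σ`. -/
def LowerAt (a c b : ℕ) (f₀ f₁ f₂ : ℕ → ℝ) (s : ℝ) (σ : Finset (ℝ × ℝ)) : Prop :=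
  ∃ p₀ p₁ p₂ q : ℝ, p₀ + p₂ = 2 * p₁ ∧ q < s ∧ ColAt a f₀ p₀ q (fun i => pt 0 i ∈ σ) ∧
    ColAt c f₁ p₁ q (fun i => pt 1 i ∈ σ) ∧ ColAt b f₂ p₂ q (fun i => pt 2 i ∈ σ)

/-- There are heights on the lattice points below the front for which all members of `F` are lower
faces, and which can be continued beyond the front. -/
def HasHeights (a c b : ℕ) (F : Set (Finset (ℝ × ℝ))) : Prop :=
  ∃ (f₀ f₁ f₂ : ℕ → ℝ) (s : ℝ), (∀ σ ∈ F, LowerAt a c b f₀ f₁ f₂ s σ) ∧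
    ColSupport a f₀ s ∧ ColSupport c f₁ s ∧ ColSupport b f₂ s ∧
    0 < 2 * (s * c - f₁ c) - (s * a - f₀ a) - (s * b - f₂ b)

/-- The strict inequality in `HasHeights` varies linearly with the slope, so it survives a small
increase of the slope. -/
lemma exists_pos_add_mul_pos {d : ℝ} (hd : 0 < d) (k : ℝ) : ∃ t, 0 < t ∧ 0 < d + t * k := by
  refine ⟨d / (1 + |k|), by positivity, ?_⟩
  have h1 : 0 < 1 + |k| := by positivity
  have : d + d / (1 + |k|) * k = d * (1 + |k| + k) / (1 + |k|) := by field_simp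
  rw [this]
  have := neg_abs_le k
  apply div_pos (mul_pos hd (by linarith)) h1

section Steps

variable {a c b : ℕ} {F : Set (Finset (ℝ × ℝ))}

lemma notMem_of_subset_frontPts {σ : Finset (ℝ × ℝ)} (h : ∀ v ∈ σ, v ∈ frontPts a c b) :
    pt 0 (a + 1) ∉ σ ∧ pt 1 (c + 1) ∉ σ ∧ pt 2 (b + 1) ∉ σ :=
  ⟨fun h' => by simpa using pt_zero_mem_frontPts.1 (h _ h'),
    fun h' => by simpa using pt_one_mem_frontPts.1 (h _ h'),
    fun h' => by simpa using pt_two_mem_frontPts.1 (h _ h')⟩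

/-- The last inequality of `HasHeights` says that the lines of slope `s` through the three column
tops have strictly convex intercepts. So the plane of slope `s` through the lifts of (0, a) and (1,
c) passes strictly below the right column. Putting the new point on this plane makes the new
triangle a lower face. Earlier cells have smaller slopes, so their planes pass below the new point.
-/
lemma HasHeights.left (h : HasHeights a c b F) (hF : ∀ σ ∈ F, ∀ v ∈ σ, v ∈ frontPts a c b) :
    HasHeights (a + 1) c b (insert (sideTri 0 a c) F) := by
  obtain ⟨f₀, f₁, f₂, s, hl, h0, h1, h2, hD⟩ := h
  obtain ⟨t, ht, htD⟩ := exists_pos_add_mul_pos hD (2 * c - (a + 1) - b)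
  refine ⟨Function.update f₀ (a + 1) (f₀ a + s), f₁, f₂, s + t, ?_, h0.update (by linarith)
    (by linarith), h1.mono (by linarith), h2.mono (by linarith), ?_⟩
  · rintro σ (rfl | hσ)
    · refine ⟨f₀ a - s * a, f₁ c - s * c, 2 * (f₁ c - s * c) - (f₀ a - s * a), s, by ring,
        by linarith, h0.colAt_update rfl rfl ?_, h1.colAt rfl ?_,
        h2.colAt_of_lt (by linarith) ?_⟩ <;> intro i <;> simp [sideTri]
    · obtain ⟨p₀, p₁, p₂, q, hp, hq, c0, c1, c2⟩ := hl σ hσ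
      exact ⟨p₀, p₁, p₂, q, hp, by linarith,
        c0.update (by linarith) (notMem_of_subset_frontPts (hF σ hσ)).1, c1, c2⟩
  · rw [Function.update_self]
    push_cast
    linarith

lemma HasHeights.right (h : HasHeights a c b F) (hF : ∀ σ ∈ F, ∀ v ∈ σ, v ∈ frontPts a c b) :
    HasHeights a c (b + 1) (insert (sideTri 2 b c) F) := by
  obtain ⟨f₀, f₁, f₂, s, hl, h0, h1, h2, hD⟩ := h
  obtain ⟨t, ht, htD⟩ := exists_pos_add_mul_pos hD (2 * c - a - (b + 1))
  refine ⟨f₀, f₁, Function.update f₂ (b + 1) (f₂ b + s), s + t, ?_, h0.mono (by linarith),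
    h1.mono (by linarith), h2.update (by linarith) (by linarith), ?_⟩
  · rintro σ (rfl | hσ)
    · refine ⟨2 * (f₁ c - s * c) - (f₂ b - s * b), f₁ c - s * c, f₂ b - s * b, s, by ring,
        by linarith, h0.colAt_of_lt (by linarith) ?_, h1.colAt rfl ?_,
        h2.colAt_update rfl rfl ?_⟩ <;> intro i <;> simp [sideTri]
    · obtain ⟨p₀, p₁, p₂, q, hp, hq, c0, c1, c2⟩ := hl σ hσ
      exact ⟨p₀, p₁, p₂, q, hp, by linarith, c0, c1,
        c2.update (by linarith) (notMem_of_subset_frontPts (hF σ hσ)).2.2⟩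
  · rw [Function.update_self]
    push_cast
    linarith

/-- The new middle point continues the line of slope `s` in its column, so it lies on the planes
over both front edges at once. -/
lemma HasHeights.mid (h : HasHeights a c b F) (hF : ∀ σ ∈ F, ∀ v ∈ σ, v ∈ frontPts a c b) :
    HasHeights a (c + 1) b (F ∪ {midTri 0 a c, midTri 2 b c}) := by
  obtain ⟨f₀, f₁, f₂, s, hl, h0, h1, h2, hD⟩ := h
  obtain ⟨t, ht, htD⟩ := exists_pos_add_mul_pos hD (2 * (c + 1) - a - b)
  refine ⟨f₀, Function.update f₁ (c + 1) (f₁ c + s), f₂, s + t, ?_, h0.mono (by linarith),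
    h1.update (by linarith) (by linarith), h2.mono (by linarith), ?_⟩
  · rintro σ (hσ | rfl | rfl)
    · obtain ⟨p₀, p₁, p₂, q, hp, hq, c0, c1, c2⟩ := hl σ hσ
      exact ⟨p₀, p₁, p₂, q, hp, by linarith, c0,
        c1.update (by linarith) (notMem_of_subset_frontPts (hF σ hσ)).2.1, c2⟩
    · refine ⟨f₀ a - s * a, f₁ c - s * c, 2 * (f₁ c - s * c) - (f₀ a - s * a), s, by ring,
        by linarith, h0.colAt rfl ?_, h1.colAt_update rfl rfl ?_,
        h2.colAt_of_lt (by linarith) ?_⟩ <;> intro i <;> simp [midTri]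
    · refine ⟨2 * (f₁ c - s * c) - (f₂ b - s * b), f₁ c - s * c, f₂ b - s * b, s, by ring,
        by linarith, h0.colAt_of_lt (by linarith) ?_, h1.colAt_update rfl rfl ?_,
        h2.colAt rfl ?_⟩ <;> intro i <;> simp [midTri]
  · rw [Function.update_self]
    push_cast
    linarith

lemma HasHeights.cross (h : HasHeights a c b F) (hF : ∀ σ ∈ F, ∀ v ∈ σ, v ∈ frontPts a c b)
    (hab : a + b = 2 * c + 1) :
    HasHeights a (c + 1) b (F ∪ {crossTri a b c, crossTri a b (c + 1)}) := by
  obtain ⟨f₀, f₁, f₂, s, hl, h0, h1, h2, hD⟩ := h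
  have hab' : (a : ℝ) + b = 2 * c + 1 := by exact_mod_cast hab
  -- As a + b = 2c + 1, the convexity gap shrinks by 1 per unit of slope. At the slope `r` where it
  -- vanishes, the three column tops lie on one supporting plane, that of the lower triangle.
  obtain ⟨r, hr, hrs⟩ : ∃ r, s < r ∧ f₀ a - r * a + (f₂ b - r * b) = 2 * (f₁ c - r * c) := by
    refine ⟨s + (2 * (s * c - f₁ c) - (s * a - f₀ a) - (s * b - f₂ b)), by linarith, ?_⟩
    have hb : (b : ℝ) = 2 * c + 1 - a := by linarith
    rw [hb]; ring
  have hrs' : f₀ a + f₂ b = 2 * (f₁ c - r * c) + r * (2 * c + 1) := by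
    rw [← hab']; linarith
  have hs0 : ∀ x : ℝ, x * a + x * b = x * (2 * c + 1) := fun x => by rw [← hab']; ring
  -- The new point is placed 1 above the plane of slope `r`, and the plane of slope `r + 2` then
  -- contains the upper triangle. With the middle top at c + 1 the gap grows by 1 per unit of slope,
  -- so it equals 1 at `r + 3`.
  refine ⟨f₀, Function.update f₁ (c + 1) (f₁ c + r + 1), f₂, r + 3, ?_, h0.mono (by linarith),
    h1.update (by linarith) (by linarith), h2.mono (by linarith), ?_⟩
  · rintro σ (hσ | rfl | rfl)
    · obtain ⟨p₀, p₁, p₂, q, hp, hq, c0, c1, c2⟩ := hl σ hσ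
      exact ⟨p₀, p₁, p₂, q, hp, by linarith, c0,
        c1.update (by linarith) (notMem_of_subset_frontPts (hF σ hσ)).2.1, c2⟩
    · refine ⟨f₀ a - r * a, f₁ c - r * c, f₂ b - r * b, r, hrs,
        by linarith, (h0.mono hr.le).colAt rfl ?_, ((h1.mono hr.le).colAt rfl ?_).update
          (by linarith) (by simp [crossTri]), (h2.mono hr.le).colAt rfl ?_⟩ <;> intro i <;>
        simp [crossTri]
    · have h1' : ColSupport (c + 1) (Function.update f₁ (c + 1) (f₁ c + r + 1)) (r + 2) :=
        h1.update (by linarith) (by linarith)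
      refine ⟨f₀ a - (r + 2) * a, f₁ c + r + 1 - (r + 2) * (c + 1), f₂ b - (r + 2) * b, r + 2,
        ?_, by linarith, (h0.mono (by linarith)).colAt rfl ?_, h1'.colAt ?_ ?_,
        (h2.mono (by linarith)).colAt rfl ?_⟩
      · have := hs0 (r + 2)
        linarith
      · intro i; simp [crossTri]
      · rw [Function.update_self]; push_cast; ring
      · intro i; simp [crossTri]
      · intro i; simp [crossTri]
  · rw [Function.update_self]
    push_cast
    have := hs0 (r + 3)
    linarith

/-- The lower cells obtained by closing the front with a single triangle. -/
lemma HasHeights.closeCross (h : HasHeights a c b F) (hab : a + b = 2 * c + 1) :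
    ∃ (f₀ f₁ f₂ : ℕ → ℝ) (s : ℝ),
      ∀ σ ∈ insert (crossTri a b c) F, LowerAt a c b f₀ f₁ f₂ s σ := by
  obtain ⟨f₀, f₁, f₂, s, hl, h0, h1, h2, hD⟩ := h
  have hab' : (a : ℝ) + b = 2 * c + 1 := by exact_mod_cast hab
  obtain ⟨r, hr, hrs⟩ : ∃ r, s < r ∧ f₀ a - r * a + (f₂ b - r * b) = 2 * (f₁ c - r * c) := by
    refine ⟨s + (2 * (s * c - f₁ c) - (s * a - f₀ a) - (s * b - f₂ b)), by linarith, ?_⟩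
    have hb : (b : ℝ) = 2 * c + 1 - a := by linarith
    rw [hb]; ring
  refine ⟨f₀, f₁, f₂, r + 1, ?_⟩
  rintro σ (rfl | hσ)
  · refine ⟨f₀ a - r * a, f₁ c - r * c, f₂ b - r * b, r, hrs,
      by linarith, (h0.mono hr.le).colAt rfl ?_, (h1.mono hr.le).colAt rfl ?_,
      (h2.mono hr.le).colAt rfl ?_⟩ <;> intro i <;> simp [crossTri]
  · obtain ⟨p₀, p₁, p₂, q, hp, hq, c0, c1, c2⟩ := hl σ hσ
    exact ⟨p₀, p₁, p₂, q, hp, by linarith, c0, c1, c2⟩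

/-! ### Covering the region below the front -/

/-- The region below the left or right part of the front is covered by `F`. -/
def IsCovered (u : ℝ) (a c : ℕ) (F : Set (Finset (ℝ × ℝ))) : Prop :=
  ∀ x y : ℝ, 0 ≤ x → x ≤ 1 → 0 ≤ y → y ≤ a + (c - a) * x →
    ∃ σ ∈ F, (u + (1 - u) * x, y) ∈ convexHull ℝ (σ : Set (ℝ × ℝ))

lemma IsCovered.mono {u : ℝ} {F' : Set (Finset (ℝ × ℝ))} (h : IsCovered u a c F) (hF : F ⊆ F') :
    IsCovered u a c F' := fun x y hx0 hx1 hy h' =>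
  let ⟨σ, hσ, hx⟩ := h x y hx0 hx1 hy h'
  ⟨σ, hF hσ, hx⟩

/-- The members of `F` are simplices filling the region below the front. -/
structure IsFilling (a c b : ℕ) (F : Set (Finset (ℝ × ℝ))) : Prop where
  nonempty : ∀ σ ∈ F, σ.Nonempty
  indep : ∀ σ ∈ F, AffineIndependent ℝ ((↑) : σ → ℝ × ℝ)
  subset : ∀ σ ∈ F, ∀ v ∈ σ, v ∈ frontPts a c b
  exists_mem : ∀ v ∈ frontPts a c b, ∃ σ ∈ F, v ∈ σ
  left : IsCovered 0 a c F
  right : IsCovered 2 b c F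

lemma mem_convexHull_of_mem {σ : Finset (ℝ × ℝ)} {v : ℝ × ℝ} (h : v ∈ σ) :
    v ∈ convexHull ℝ (σ : Set (ℝ × ℝ)) := subset_convexHull ℝ _ h

lemma IsFilling.addLeft (h : IsFilling a c b F) :
    IsFilling (a + 1) c b (insert (sideTri 0 a c) F) where
  nonempty := by
    rintro σ (rfl | hσ)
    · simp [sideTri]
    · exact h.nonempty σ hσ
  indep := by
    rintro σ (rfl | hσ)
    · exact affineIndependent_sideTri (by norm_num) a c
    · exact h.indep σ hσ
  subset := by
    rintro σ (rfl | hσ) v hv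
    · simp only [sideTri, Finset.mem_insert, Finset.mem_singleton] at hv
      rcases hv with rfl | rfl | rfl <;> simp [frontPts]
    · exact frontPts_mono (by simp) le_rfl le_rfl (h.subset σ hσ v hv)
  exists_mem := by
    intro v hv
    by_cases hv' : v = pt 0 (a + 1)
    · exact ⟨_, Set.mem_insert _ _, by simp [sideTri, hv']⟩
    · obtain ⟨σ, hσ, h⟩ := h.exists_mem v (by
        rcases hv with ⟨i, hi, rfl⟩ | hv
        · refine pt_zero_mem_frontPts.2 ?_
          simp only [pt_inj, true_and] at hv'
          omega
        · exact Or.inr hv)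
      exact ⟨σ, Set.mem_insert_of_mem _ hσ, h⟩
  left := by
    intro x y hx0 hx1 hy hle
    by_cases h' : y ≤ a + (c - a) * x
    · exact (h.left.mono (Set.subset_insert _ _)) x y hx0 hx1 hy h'
    · exact ⟨_, Set.mem_insert _ _, mem_of_between_side (convex_convexHull ℝ _)
        (mem_convexHull_of_mem (by simp [sideTri])) (mem_convexHull_of_mem (by simp [sideTri]))
        (mem_convexHull_of_mem (by simp [sideTri])) hx0 (not_le.1 h').le hle⟩
  right := h.right.mono (Set.subset_insert _ _)

lemma IsFilling.addRight (h : IsFilling a c b F) :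
    IsFilling a c (b + 1) (insert (sideTri 2 b c) F) where
  nonempty := by
    rintro σ (rfl | hσ)
    · simp [sideTri]
    · exact h.nonempty σ hσ
  indep := by
    rintro σ (rfl | hσ)
    · exact affineIndependent_sideTri (by norm_num) b c
    · exact h.indep σ hσ
  subset := by
    rintro σ (rfl | hσ) v hv
    · simp only [sideTri, Finset.mem_insert, Finset.mem_singleton] at hv
      rcases hv with rfl | rfl | rfl <;> simp [frontPts]
    · exact frontPts_mono le_rfl le_rfl (by simp) (h.subset σ hσ v hv)
  exists_mem := by
    intro v hv
    by_cases hv' : v = pt 2 (b + 1)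
    · exact ⟨_, Set.mem_insert _ _, by simp [sideTri, hv']⟩
    · obtain ⟨σ, hσ, h⟩ := h.exists_mem v (by
        rcases hv with hv | hv | ⟨i, hi, rfl⟩
        · exact Or.inl hv
        · exact Or.inr (Or.inl hv)
        · refine pt_two_mem_frontPts.2 ?_
          simp only [pt_inj, true_and] at hv'
          omega)
      exact ⟨σ, Set.mem_insert_of_mem _ hσ, h⟩
  left := h.left.mono (Set.subset_insert _ _)
  right := by
    intro x y hx0 hx1 hy hle
    by_cases h' : y ≤ b + (c - b) * x
    · exact (h.right.mono (Set.subset_insert _ _)) x y hx0 hx1 hy h'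
    · exact ⟨_, Set.mem_insert _ _, mem_of_between_side (convex_convexHull ℝ _)
        (mem_convexHull_of_mem (by simp [sideTri])) (mem_convexHull_of_mem (by simp [sideTri]))
        (mem_convexHull_of_mem (by simp [sideTri])) hx0 (not_le.1 h').le hle⟩

lemma exists_mem_of_succ_mid {F' : Set (Finset (ℝ × ℝ))} (h : IsFilling a c b F) (hF : F ⊆ F')
    {τ : Finset (ℝ × ℝ)} (hτ : τ ∈ F') (hτ' : pt 1 (c + 1) ∈ τ) :
    ∀ v ∈ frontPts a (c + 1) b, ∃ σ ∈ F', v ∈ σ := by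
  intro v hv
  by_cases hv' : v = pt 1 (c + 1)
  · exact ⟨_, hτ, hv' ▸ hτ'⟩
  · obtain ⟨σ, hσ, h⟩ := h.exists_mem v (by
      rcases hv with hv | ⟨i, hi, rfl⟩ | hv
      · exact Or.inl hv
      · refine pt_one_mem_frontPts.2 ?_
        simp only [pt_inj, true_and] at hv'
        omega
      · exact Or.inr (Or.inr hv))
    exact ⟨σ, hF hσ, h⟩

lemma IsFilling.addMid (h : IsFilling a c b F) :
    IsFilling a (c + 1) b (F ∪ {midTri 0 a c, midTri 2 b c}) where
  nonempty := by
    rintro σ (hσ | rfl | rfl)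
    · exact h.nonempty σ hσ
    all_goals simp [midTri]
  indep := by
    rintro σ (hσ | rfl | rfl)
    · exact h.indep σ hσ
    · exact affineIndependent_midTri (by norm_num) a c
    · exact affineIndependent_midTri (by norm_num) b c
  subset := by
    rintro σ (hσ | rfl | rfl) v hv
    · exact frontPts_mono le_rfl (by simp) le_rfl (h.subset σ hσ v hv)
    all_goals
      simp only [midTri, Finset.mem_insert, Finset.mem_singleton] at hv
      rcases hv with rfl | rfl | rfl <;> simp [frontPts]
  exists_mem := exists_mem_of_succ_mid h Set.subset_union_left (τ := midTri 0 a c) (by simp)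
    (by simp [midTri])
  left := by
    intro x y hx0 hx1 hy hle
    by_cases h' : y ≤ a + (c - a) * x
    · exact (h.left.mono Set.subset_union_left) x y hx0 hx1 hy h'
    · exact ⟨midTri 0 a c, by simp, mem_of_between_mid (convex_convexHull ℝ _)
        (mem_convexHull_of_mem (by simp [midTri])) (mem_convexHull_of_mem (by simp [midTri]))
        (mem_convexHull_of_mem (by simp [midTri])) hx1 (not_le.1 h').le hle⟩
  right := by
    intro x y hx0 hx1 hy hle
    by_cases h' : y ≤ b + (c - b) * x
    · exact (h.right.mono Set.subset_union_left) x y hx0 hx1 hy h'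
    · exact ⟨midTri 2 b c, by simp, mem_of_between_mid (convex_convexHull ℝ _)
        (mem_convexHull_of_mem (by simp [midTri])) (mem_convexHull_of_mem (by simp [midTri]))
        (mem_convexHull_of_mem (by simp [midTri])) hx1 (not_le.1 h').le hle⟩

/-- This is needed both for a crossed middle segment and for the closing triangle under the top edge
when A + B is odd. -/
lemma IsFilling.below_cross (h : IsFilling a c b F) (hab : a + b = 2 * c + 1) {x y : ℝ}
    (hx0 : 0 ≤ x) (hx1 : x ≤ 1) (hy : 0 ≤ y) :
    (y ≤ a + ((a + b : ℝ) / 2 - a) * x → ∃ σ ∈ insert (crossTri a b c) F,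
      (0 + (1 - 0) * x, y) ∈ convexHull ℝ (σ : Set (ℝ × ℝ))) ∧
    (y ≤ b + ((a + b : ℝ) / 2 - b) * x → ∃ σ ∈ insert (crossTri a b c) F,
      (2 + (1 - 2) * x, y) ∈ convexHull ℝ (σ : Set (ℝ × ℝ))) := by
  refine ⟨fun hle => ?_, fun hle => ?_⟩
  · by_cases h' : y ≤ a + (c - a) * x
    · exact (h.left.mono (Set.subset_insert _ _)) x y hx0 hx1 hy h'
    · exact ⟨_, Set.mem_insert _ _, mem_of_below_cross (convex_convexHull ℝ _) (b := b) hab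
        (mem_convexHull_of_mem (by simp [crossTri])) (mem_convexHull_of_mem (by simp [crossTri]))
        (mem_convexHull_of_mem (by simp [crossTri])) hx1 (not_le.1 h').le hle⟩
  · by_cases h' : y ≤ b + (c - b) * x
    · exact (h.right.mono (Set.subset_insert _ _)) x y hx0 hx1 hy h'
    · exact ⟨_, Set.mem_insert _ _, mem_of_below_cross (convex_convexHull ℝ _) (b := a)
        (by omega)
        (mem_convexHull_of_mem (by simp [crossTri])) (mem_convexHull_of_mem (by simp [crossTri]))
        (mem_convexHull_of_mem (by simp [crossTri])) hx1 (not_le.1 h').le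
        (by rwa [add_comm (b : ℝ) a])⟩

lemma IsFilling.addCross (h : IsFilling a c b F) (hab : a + b = 2 * c + 1) :
    IsFilling a (c + 1) b (F ∪ {crossTri a b c, crossTri a b (c + 1)}) where
  nonempty := by
    rintro σ (hσ | rfl | rfl)
    · exact h.nonempty σ hσ
    all_goals simp [crossTri]
  indep := by
    rintro σ (hσ | rfl | rfl)
    · exact h.indep σ hσ
    · exact affineIndependent_crossTri (by omega)
    · exact affineIndependent_crossTri (by omega)
  subset := by
    rintro σ (hσ | rfl | rfl) v hv
    · exact frontPts_mono le_rfl (by simp) le_rfl (h.subset σ hσ v hv)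
    all_goals
      simp only [crossTri, Finset.mem_insert, Finset.mem_singleton] at hv
      rcases hv with rfl | rfl | rfl <;> simp [frontPts]
  exists_mem := exists_mem_of_succ_mid h Set.subset_union_left (τ := crossTri a b (c + 1))
    (by simp) (by simp [crossTri])
  left := by
    intro x y hx0 hx1 hy hle
    by_cases h' : y ≤ a + ((a + b : ℝ) / 2 - a) * x
    · obtain ⟨σ, hσ, hx⟩ := (h.below_cross hab hx0 hx1 hy).1 h'
      refine ⟨σ, ?_, hx⟩
      rcases hσ with rfl | hσ
      · simp
      · exact Or.inl hσ
    · exact ⟨crossTri a b (c + 1), by simp, mem_of_above_cross (convex_convexHull ℝ _) (b := b) hab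
        (mem_convexHull_of_mem (by simp [crossTri])) (mem_convexHull_of_mem (by simp [crossTri]))
        (mem_convexHull_of_mem (by simp [crossTri])) hx1 (not_le.1 h').le hle⟩
  right := by
    intro x y hx0 hx1 hy hle
    by_cases h' : y ≤ b + ((a + b : ℝ) / 2 - b) * x
    · obtain ⟨σ, hσ, hx⟩ := (h.below_cross hab hx0 hx1 hy).2 h'
      refine ⟨σ, ?_, hx⟩
      rcases hσ with rfl | hσ
      · simp
      · exact Or.inl hσ
    · exact ⟨crossTri a b (c + 1), by simp, mem_of_above_cross (convex_convexHull ℝ _) (b := a)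
        (by omega)
        (mem_convexHull_of_mem (by simp [crossTri])) (mem_convexHull_of_mem (by simp [crossTri]))
        (mem_convexHull_of_mem (by simp [crossTri])) hx1
        (by rw [add_comm (b : ℝ) a]; exact (not_le.1 h').le) hle⟩

/-- The two edges on the bottom line. -/
def bottomEdges : Set (Finset (ℝ × ℝ)) := {{pt 0 0, pt 1 0}, {pt 2 0, pt 1 0}}

lemma isFilling_bottomEdges : IsFilling 0 0 0 bottomEdges where
  nonempty := by rintro σ (rfl | rfl) <;> simp
  indep := by
    rintro σ (rfl | rfl)
    · exact affineIndependent_bottomEdge (by norm_num)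
    · exact affineIndependent_bottomEdge (by norm_num)
  subset := by
    rintro σ (rfl | rfl) v hv <;> simp only [Finset.mem_insert, Finset.mem_singleton] at hv <;>
    rcases hv with rfl | rfl <;> simp [frontPts]
  exists_mem := by
    rintro v (⟨i, hi, rfl⟩ | ⟨i, hi, rfl⟩ | ⟨i, hi, rfl⟩)
    · obtain rfl := Nat.le_zero.1 hi
      exact ⟨_, Or.inl rfl, by simp⟩
    · obtain rfl := Nat.le_zero.1 hi
      exact ⟨_, Or.inl rfl, by simp⟩
    · obtain rfl := Nat.le_zero.1 hi
      exact ⟨_, Or.inr rfl, by simp⟩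
  left := by
    intro x y hx0 hx1 hy hle
    have hy0 : y = 0 := le_antisymm (by simpa using hle) hy
    refine ⟨_, Or.inl rfl, (convex_convexHull ℝ _).triple_mem
      (mem_convexHull_of_mem (v := pt 0 0) (by simp))
      (mem_convexHull_of_mem (v := pt 1 0) (by simp))
      (mem_convexHull_of_mem (v := pt 1 0) (by simp)) (x := 1 - x) (y := x) (z := 0)
      (by linarith) hx0 le_rfl (by ring) ?_ ?_⟩ <;> simp [hy0]
  right := by
    intro x y hx0 hx1 hy hle
    have hy0 : y = 0 := le_antisymm (by simpa using hle) hy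
    refine ⟨_, Or.inr rfl, (convex_convexHull ℝ _).triple_mem
      (mem_convexHull_of_mem (v := pt 2 0) (by simp))
      (mem_convexHull_of_mem (v := pt 1 0) (by simp))
      (mem_convexHull_of_mem (v := pt 1 0) (by simp)) (x := 1 - x) (y := x) (z := 0)
      (by linarith) hx0 le_rfl (by ring) ?_ ?_⟩ <;> simp [hy0]
    ring

lemma hasHeights_bottomEdges : HasHeights 0 0 0 bottomEdges := by
  -- Raising the outer columns by 1 creates a convexity gap of 2. The planes over the two edges get
  -- slope -1, below the slope 0 of the front.
  refine ⟨fun _ => 1, fun _ => 0, fun _ => 1, 0, ?_, fun i hi => by simp at hi,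
    fun i hi => by simp at hi, fun i hi => by simp at hi, by simp⟩
  rintro σ (rfl | rfl)
  · refine ⟨1, 0, -1, -1, by norm_num, by norm_num, ?_, ?_, ?_⟩ <;> intro i hi <;>
    obtain rfl := Nat.le_zero.1 hi <;> norm_num
  · refine ⟨-1, 0, 1, -1, by norm_num, by norm_num, ?_, ?_, ?_⟩ <;> intro i hi <;>
    obtain rfl := Nat.le_zero.1 hi <;> norm_num

end Steps

/-! ### The trapezoid and its lattice points -/

lemma mem_rightTrapezoid {A B : ℕ} {x y : ℝ} :
    (x, y) ∈ rightTrapezoid A B ↔ 0 ≤ x ∧ x ≤ 2 ∧ 0 ≤ y ∧ y ≤ A + ((B : ℝ) - A) * (x / 2) := by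
  constructor
  · have hconv : Convex ℝ {p : ℝ × ℝ | 0 ≤ p.1 ∧ p.1 ≤ 2 ∧ 0 ≤ p.2 ∧
        p.2 ≤ A + ((B : ℝ) - A) * (p.1 / 2)} := by
      rintro p ⟨hp1, hp2, hp3, hp4⟩ q ⟨hq1, hq2, hq3, hq4⟩ s t hs ht hst
      have e : (A : ℝ) = s * A + t * A := by rw [← add_mul, hst, one_mul]
      refine ⟨?_, ?_, ?_, ?_⟩ <;> simp only [Prod.fst_add, Prod.smul_fst, Prod.snd_add,
        Prod.smul_snd, smul_eq_mul]
      · positivity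
      · nlinarith
      · positivity
      · have h1 := mul_le_mul_of_nonneg_left hp4 hs
        have h2 := mul_le_mul_of_nonneg_left hq4 ht
        linarith
    intro h
    refine convexHull_min ?_ hconv h
    rintro p (rfl | rfl | rfl | rfl) <;> norm_num
  · rintro ⟨hx0, hx2, hy0, hy⟩
    have hS : Convex ℝ (rightTrapezoid A B) := convex_convexHull ℝ _
    have h1 : ((0 : ℝ), (0 : ℝ)) ∈ rightTrapezoid A B := subset_convexHull ℝ _ (by simp)
    have h2 : ((0 : ℝ), (A : ℝ)) ∈ rightTrapezoid A B := subset_convexHull ℝ _ (by simp)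
    have h3 : ((2 : ℝ), (0 : ℝ)) ∈ rightTrapezoid A B := subset_convexHull ℝ _ (by simp)
    have h4 : ((2 : ℝ), (B : ℝ)) ∈ rightTrapezoid A B := subset_convexHull ℝ _ (by simp)
    set H := A + ((B : ℝ) - A) * (x / 2) with hH
    have hbot : (x, (0 : ℝ)) ∈ rightTrapezoid A B :=
      hS.triple_mem h1 h3 h3 (x := 1 - x / 2) (y := x / 2) (z := 0) (by linarith) (by linarith)
        le_rfl (by ring) (by simp) (by simp)
    have htop : (x, H) ∈ rightTrapezoid A B :=
      hS.triple_mem h2 h4 h4 (x := 1 - x / 2) (y := x / 2) (z := 0) (by linarith) (by linarith)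
        le_rfl (by ring) (by simp) (by simp [hH]; ring)
    rcases (hy0.trans hy).eq_or_lt with h0 | hpos
    · have : y = 0 := by linarith
      rwa [this]
    · refine hS.triple_mem hbot htop htop (x := 1 - y / H) (y := y / H) (z := 0) ?_ (by positivity)
        le_rfl (by ring) (by simp; ring) ?_
      · rw [sub_nonneg, div_le_one hpos]; exact hy
      · simp; field_simp

lemma latticePoints_rightTrapezoid (A B : ℕ) :
    latticePoints (rightTrapezoid A B) = frontPts A ((A + B) / 2) B := by
  ext v
  constructor
  · rintro ⟨hv, a, b, rfl⟩
    obtain ⟨h1, h2, h3, h4⟩ := mem_rightTrapezoid.1 hv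
    have h1' : 0 ≤ a := by exact_mod_cast h1
    have h2' : a ≤ 2 := by exact_mod_cast h2
    have h3' : 0 ≤ b := by exact_mod_cast h3
    have h4' : (2 : ℝ) * b ≤ 2 * A + (B - A) * a := by linarith
    have h5 : (2 : ℤ) * b ≤ 2 * A + (B - A) * a := by exact_mod_cast h4'
    lift b to ℕ using h3'
    interval_cases a
    · exact Or.inl ⟨b, by omega, by simp [pt]⟩
    · exact Or.inr (Or.inl ⟨b, by omega, by simp [pt]⟩)
    · exact Or.inr (Or.inr ⟨b, by omega, by simp [pt]⟩)
  · rintro (⟨i, hi, rfl⟩ | ⟨i, hi, rfl⟩ | ⟨i, hi, rfl⟩)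
    · have : (i : ℝ) ≤ A := by exact_mod_cast hi
      exact ⟨mem_rightTrapezoid.2 ⟨by norm_num, by norm_num, by positivity, by linarith⟩,
        0, i, by simp [pt]⟩
    · have : 2 * i ≤ A + B := by omega
      have : (2 : ℝ) * i ≤ A + B := by exact_mod_cast this
      exact ⟨mem_rightTrapezoid.2 ⟨by norm_num, by norm_num, by positivity, by linarith⟩,
        1, i, by simp [pt]⟩
    · have : (i : ℝ) ≤ B := by exact_mod_cast hi
      exact ⟨mem_rightTrapezoid.2 ⟨by norm_num, by norm_num, by positivity, by linarith⟩,
        2, i, by simp [pt]⟩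

lemma finite_frontPts (a c b : ℕ) : (frontPts a c b).Finite := by
  have : frontPts a c b ⊆ (pt 0 '' Set.Iic a) ∪ (pt 1 '' Set.Iic c) ∪ (pt 2 '' Set.Iic b) := by
    rintro v (⟨i, hi, rfl⟩ | ⟨i, hi, rfl⟩ | ⟨i, hi, rfl⟩)
    · exact Or.inl (Or.inl ⟨i, hi, rfl⟩)
    · exact Or.inl (Or.inr ⟨i, hi, rfl⟩)
    · exact Or.inr ⟨i, hi, rfl⟩
  exact ((((Set.finite_Iic a).image _).union ((Set.finite_Iic c).image _)).union
    ((Set.finite_Iic b).image _)).subset this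

/-! ### From rows to triangulations -/

/-- A row of a triangulation of a trapezoid consists of the heights of the left and right apex of
the triangles at a unit segment of the middle column, and says whether the segment is replaced by
the edge connecting the two apices. -/
abbrev Row := ℕ × ℕ × Bool

/-- The height of the left apex of the top row. -/
def leftTop : List Row → ℕ
  | [] => 0
  | r :: _ => r.1

/-- The height of the right apex of the top row. -/
def rightTop : List Row → ℕ
  | [] => 0
  | r :: _ => r.2.1

/-- The rows of a triangulation, the top row being the first one. -/
def IsRows : List Row → Prop
  | [] => True
  | r :: l => leftTop l ≤ r.1 ∧ rightTop l ≤ r.2.1 ∧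
      (r.2.2 = true → r.1 + r.2.1 = 2 * l.length + 1) ∧ IsRows l

/-- The triangles with apex `(1, c)` and an edge in the column `u` between heights `a` and `a'`. -/
def sideCells (u : ℝ) (a a' c : ℕ) : Set (Finset (ℝ × ℝ)) :=
  {σ | ∃ i, a ≤ i ∧ i < a' ∧ σ = sideTri u i c}

/-- The two triangles of a row. -/
noncomputable def rowCells (r : Row) (c : ℕ) : Set (Finset (ℝ × ℝ)) :=
  if r.2.2 then {crossTri r.1 r.2.1 c, crossTri r.1 r.2.1 (c + 1)}
  else {midTri 0 r.1 c, midTri 2 r.2.1 c}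

/-- The cells of a triangulation with given rows up to the top row. -/
noncomputable def cells : List Row → Set (Finset (ℝ × ℝ))
  | [] => bottomEdges
  | r :: l => cells l ∪ sideCells 0 (leftTop l) r.1 l.length ∪
      sideCells 2 (rightTop l) r.2.1 l.length ∪ rowCells r l.length

/-- The cells of a triangulation with given rows up to the front through `(0, a)`, `(2, b)`. -/
noncomputable def frontCells (l : List Row) (a b : ℕ) : Set (Finset (ℝ × ℝ)) :=
  cells l ∪ sideCells 0 (leftTop l) a l.length ∪ sideCells 2 (rightTop l) b l.length

/-- All cells of a triangulation with given rows. -/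
noncomputable def totalCells (l : List Row) (a b : ℕ) : Set (Finset (ℝ × ℝ)) :=
  if (a + b) % 2 = 1 then insert (crossTri a b l.length) (frontCells l a b) else frontCells l a b

lemma cells_cons (r : Row) (l : List Row) :
    cells (r :: l) = frontCells l r.1 r.2.1 ∪ rowCells r l.length := rfl

lemma sideCells_self (u : ℝ) (a c : ℕ) : sideCells u a a c = ∅ := by
  ext σ
  simp only [sideCells, Set.mem_ofPred_eq, Set.mem_empty_iff_false, iff_false]
  rintro ⟨i, h1, h2, -⟩
  omega

lemma sideCells_succ (u : ℝ) {a a' : ℕ} (h : a ≤ a') (c : ℕ) :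
    sideCells u a (a' + 1) c = insert (sideTri u a' c) (sideCells u a a' c) := by
  ext σ
  constructor
  · rintro ⟨i, h1, h2, rfl⟩
    rcases (Nat.lt_succ_iff.1 h2).eq_or_lt with rfl | h3
    · exact Or.inl rfl
    · exact Or.inr ⟨i, h1, h3, rfl⟩
  · rintro (rfl | ⟨i, h1, h2, rfl⟩)
    · exact ⟨a', h, a'.lt_succ_self, rfl⟩
    · exact ⟨i, h1, by omega, rfl⟩

lemma frontCells_top (l : List Row) : frontCells l (leftTop l) (rightTop l) = cells l := by
  simp [frontCells, sideCells_self]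

lemma frontCells_succ_left {l : List Row} {a : ℕ} (h : leftTop l ≤ a) (b : ℕ) :
    frontCells l (a + 1) b = insert (sideTri 0 a l.length) (frontCells l a b) := by
  rw [frontCells, frontCells, sideCells_succ 0 h]
  simp [Set.union_insert, Set.insert_union]

lemma frontCells_succ_right {l : List Row} (a : ℕ) {b : ℕ} (h : rightTop l ≤ b) :
    frontCells l a (b + 1) = insert (sideTri 2 b l.length) (frontCells l a b) := by
  rw [frontCells, frontCells, sideCells_succ 2 h]
  simp [Set.union_insert]

lemma frontCells_spec_of_cells {l : List Row}
    (h : IsFilling (leftTop l) l.length (rightTop l) (cells l))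
    (h' : HasHeights (leftTop l) l.length (rightTop l) (cells l)) {a b : ℕ}
    (ha : leftTop l ≤ a) (hb : rightTop l ≤ b) :
    IsFilling a l.length b (frontCells l a b) ∧ HasHeights a l.length b (frontCells l a b) := by
  induction a, ha using Nat.le_induction with
  | base =>
    induction b, hb using Nat.le_induction with
    | base => rw [frontCells_top]; exact ⟨h, h'⟩
    | succ b hb ih =>
      rw [frontCells_succ_right _ hb]
      exact ⟨ih.1.addRight, ih.2.right ih.1.subset⟩
  | succ a ha ih =>
    rw [frontCells_succ_left ha]
    exact ⟨ih.1.addLeft, ih.2.left ih.1.subset⟩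

lemma cells_spec {l : List Row} (hl : IsRows l) :
    IsFilling (leftTop l) l.length (rightTop l) (cells l) ∧
      HasHeights (leftTop l) l.length (rightTop l) (cells l) := by
  induction l with
  | nil => exact ⟨isFilling_bottomEdges, hasHeights_bottomEdges⟩
  | cons r l ih =>
    obtain ⟨a, b, f⟩ := r
    obtain ⟨ha, hb, hf, hl⟩ := hl
    obtain ⟨h1, h2⟩ := frontCells_spec_of_cells (ih hl).1 (ih hl).2 ha hb
    rw [cells_cons]
    cases f with
    | true => exact ⟨h1.addCross (hf rfl), h2.cross h1.subset (hf rfl)⟩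
    | false => exact ⟨h1.addMid, h2.mid h1.subset⟩

lemma frontCells_spec {l : List Row} (hl : IsRows l) {a b : ℕ} (ha : leftTop l ≤ a)
    (hb : rightTop l ≤ b) :
    IsFilling a l.length b (frontCells l a b) ∧ HasHeights a l.length b (frontCells l a b) :=
  frontCells_spec_of_cells (cells_spec hl).1 (cells_spec hl).2 ha hb

lemma LowerAt.exists_affVal {a c b : ℕ} {f₀ f₁ f₂ : ℕ → ℝ} {s : ℝ} {σ : Finset (ℝ × ℝ)}
    (h : LowerAt a c b f₀ f₁ f₂ s σ) {ω : ℝ × ℝ → ℝ} (h0 : ∀ i, ω (pt 0 i) = f₀ i)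
    (h1 : ∀ i, ω (pt 1 i) = f₁ i) (h2 : ∀ i, ω (pt 2 i) = f₂ i) :
    ∃ d, ∀ v ∈ frontPts a c b, affVal d v ≤ ω v ∧ (affVal d v = ω v ↔ v ∈ σ) := by
  obtain ⟨p₀, p₁, p₂, q, hp, -, c0, c1, c2⟩ := h
  refine ⟨(p₀, p₁ - p₀, q), ?_⟩
  rintro v (⟨i, hi, rfl⟩ | ⟨i, hi, rfl⟩ | ⟨i, hi, rfl⟩)
  · have : affVal (p₀, p₁ - p₀, q) (pt 0 i) = p₀ + q * i := by simp [affVal]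
    rw [this, h0]; exact c0 i hi
  · have : affVal (p₀, p₁ - p₀, q) (pt 1 i) = p₁ + q * i := by simp [affVal]
    rw [this, h1]; exact c1 i hi
  · have : affVal (p₀, p₁ - p₀, q) (pt 2 i) = p₂ + q * i := by
      simp [affVal]; linarith
    rw [this, h2]; exact c2 i hi

lemma exists_heights (f₀ f₁ f₂ : ℕ → ℝ) : ∃ ω : ℝ × ℝ → ℝ, (∀ i, ω (pt 0 i) = f₀ i) ∧
    (∀ i, ω (pt 1 i) = f₁ i) ∧ ∀ i, ω (pt 2 i) = f₂ i := by
  classical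
  exact ⟨fun v => if v.1 = 0 then f₀ ⌊v.2⌋₊ else if v.1 = 1 then f₁ ⌊v.2⌋₊ else f₂ ⌊v.2⌋₊,
    by simp, by simp, by simp⟩

/-- Cells of heights filling a trapezoid are those of a fine regular triangulation. -/
lemma totalCells_spec {l : List Row} (hl : IsRows l) {A B : ℕ} (hlen : l.length = (A + B) / 2)
    (ha : leftTop l ≤ A) (hb : rightTop l ≤ B) :
    (∀ σ ∈ totalCells l A B, σ.Nonempty) ∧
    (∀ x ∈ rightTrapezoid A B, ∃ σ ∈ totalCells l A B, x ∈ convexHull ℝ (σ : Set (ℝ × ℝ))) ∧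
    ∃ ω, IsLowerCells (latticePoints (rightTrapezoid A B)) ω (totalCells l A B) := by
  obtain ⟨h1, h2⟩ := frontCells_spec hl ha hb
  rw [latticePoints_rightTrapezoid, ← hlen, totalCells]
  split_ifs with hpar
  · have hab : A + B = 2 * l.length + 1 := by omega
    refine ⟨?_, ?_, ?_⟩
    · rintro σ (rfl | hσ)
      · simp [crossTri]
      · exact h1.nonempty σ hσ
    · rintro ⟨x, y⟩ hx
      obtain ⟨hx0, hx2, hy0, hy⟩ := mem_rightTrapezoid.1 hx
      rcases le_total x 1 with hx1 | hx1
      · have := (h1.below_cross hab hx0 hx1 hy0).1 (by linarith)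
        simpa using this
      · have := (h1.below_cross hab (x := 2 - x) (by linarith) (by linarith) hy0).2 (by linarith)
        rwa [show 2 + (1 - 2) * (2 - x) = x by ring] at this
    · obtain ⟨f₀, f₁, f₂, s, hlow⟩ := h2.closeCross hab
      obtain ⟨ω, hω0, hω1, hω2⟩ := exists_heights f₀ f₁ f₂
      refine ⟨ω, ?_, ?_, ?_, fun σ hσ => (hlow σ hσ).exists_affVal hω0 hω1 hω2⟩
      · rintro σ (rfl | hσ)
        · exact affineIndependent_crossTri (by omega)
        · exact h1.indep σ hσ
      · rintro σ (rfl | hσ) v hv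
        · simp only [crossTri, Finset.mem_insert, Finset.mem_singleton] at hv
          rcases hv with rfl | rfl | rfl <;> simp [frontPts]
        · exact h1.subset σ hσ v hv
      · intro v hv
        obtain ⟨σ, hσ, h⟩ := h1.exists_mem v hv
        exact ⟨σ, Or.inr hσ, h⟩
  · have hab : A + B = 2 * l.length := by omega
    have hab' : (A : ℝ) + B = 2 * (l.length : ℕ) := by exact_mod_cast hab
    have hc : ((l.length : ℕ) : ℝ) = (A + B) / 2 := by linarith
    refine ⟨h1.nonempty, ?_, ?_⟩
    · rintro ⟨x, y⟩ hx
      obtain ⟨hx0, hx2, hy0, hy⟩ := mem_rightTrapezoid.1 hx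
      rcases le_total x 1 with hx1 | hx1
      · have := h1.left x y hx0 hx1 hy0 (by rw [hc]; linarith)
        simpa using this
      · have := h1.right (2 - x) y (by linarith) (by linarith) hy0 (by rw [hc]; linarith)
        rwa [show 2 + (1 - 2) * (2 - x) = x by ring] at this
    · obtain ⟨f₀, f₁, f₂, s, hlow, -⟩ := h2
      obtain ⟨ω, hω0, hω1, hω2⟩ := exists_heights f₀ f₁ f₂
      exact ⟨ω, h1.indep, h1.subset, h1.exists_mem,
        fun σ hσ => (hlow σ hσ).exists_affVal hω0 hω1 hω2⟩

lemma exists_triangulation {l : List Row} (hl : IsRows l) {A B : ℕ}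
    (hlen : l.length = (A + B) / 2) (ha : leftTop l ≤ A) (hb : rightTop l ≤ B) :
    ∃ T : SimplicialComplex ℝ (ℝ × ℝ), IsFineTriangulation (rightTrapezoid A B) T ∧
      IsRegularTriangulation (rightTrapezoid A B) T ∧ totalCells l A B ⊆ T.faces := by
  obtain ⟨hne, hcov, ω, h⟩ := totalCells_spec hl hlen ha hb
  have hfin : (latticePoints (rightTrapezoid A B)).Finite := by
    rw [latticePoints_rightTrapezoid]; exact finite_frontPts _ _ _
  refine ⟨h.complex, h.isFineTriangulation_complex (convex_convexHull ℝ _) hne hcov,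
    h.isRegularTriangulation_complex (V := hfin.toFinset) (by simp) fun x hx => hcov x ?_,
    h.subset_complex_faces hne⟩
  exact convexHull_min (fun v hv => hv.1) (convex_convexHull ℝ _) hx

/-- The cells already cover the trapezoid, so the faces of either complex are exactly their nonempty
subsets. -/
lemma eq_of_totalCells_subset {l : List Row} (hl : IsRows l) {A B : ℕ}
    (hlen : l.length = (A + B) / 2) (ha : leftTop l ≤ A) (hb : rightTop l ≤ B)
    {T T' : SimplicialComplex ℝ (ℝ × ℝ)} (hT : IsFineTriangulation (rightTrapezoid A B) T)
    (hT' : IsFineTriangulation (rightTrapezoid A B) T') (h : totalCells l A B ⊆ T.faces)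
    (h' : totalCells l A B ⊆ T'.faces) : T = T' := by
  obtain ⟨-, hcov, -⟩ := totalCells_spec hl hlen ha hb
  ext s
  rw [SimplicialComplex.mem_faces_iff_of_cover h (by rw [hT.1.1]; exact hcov),
    SimplicialComplex.mem_faces_iff_of_cover h' (by rw [hT'.1.1]; exact hcov)]

/-! ### Lattice points inside hulls of column points -/

section Position

variable {S : Set (ℝ × ℝ)}

lemma pt_mem_of_between (hS : Convex ℝ S) {w : ℝ} {i j k : ℕ} (hi : pt w i ∈ S) (hj : pt w j ∈ S)
    (hik : i ≤ k) (hkj : k ≤ j) : pt w k ∈ S := by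
  rcases hik.eq_or_lt with rfl | hlt
  · exact hi
  have h1 : (i : ℝ) < k := by exact_mod_cast hlt
  have h2 : (k : ℝ) ≤ j := by exact_mod_cast hkj
  have h3 : (0 : ℝ) < j - i := by linarith
  refine hS.triple_mem hi hj hj (x := 1 - (k - i) / (j - i)) (y := (k - i) / (j - i)) (z := 0)
    ?_ (div_nonneg (by linarith) h3.le) le_rfl (by ring) (by simp; ring) ?_
  · rw [sub_nonneg, div_le_one h3]; linarith
  · simp; field_simp; ring

lemma pt_one_mem_of_mean (hS : Convex ℝ S) {u : ℝ} {a b k : ℕ} (ha : pt u a ∈ S)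
    (hb : pt (2 - u) b ∈ S) (h : a + b = 2 * k) : pt 1 k ∈ S := by
  have h' : (a : ℝ) + b = 2 * k := by exact_mod_cast h
  refine hS.triple_mem ha hb hb (x := 1 / 2) (y := 1 / 2) (z := 0) (by norm_num) (by norm_num)
    le_rfl (by norm_num) (by simp; ring) ?_
  simp; linarith

lemma pt_one_mem_of_le_mean (hS : Convex ℝ S) {u : ℝ} {a b c k : ℕ} (ha : pt u a ∈ S)
    (hb : pt (2 - u) b ∈ S) (hc : pt 1 c ∈ S) (hck : c < k) (h : 2 * k ≤ a + b) :
    pt 1 k ∈ S := by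
  have h1 : (2 : ℝ) * k ≤ a + b := by exact_mod_cast h
  have h2 : (c : ℝ) < k := by exact_mod_cast hck
  have h3 : (0 : ℝ) < a + b - 2 * c := by linarith
  refine hS.triple_mem ha hb hc (x := (k - c) / (a + b - 2 * c)) (y := (k - c) / (a + b - 2 * c))
    (z := 1 - 2 * ((k - c) / (a + b - 2 * c))) (div_nonneg (by linarith) h3.le)
    (div_nonneg (by linarith) h3.le) ?_ (by ring) (by simp; ring) ?_
  · rw [sub_nonneg, ← mul_div_assoc, div_le_one h3]; linarith
  · have : (k - c) / ((a : ℝ) + b - 2 * c) * (a + b - 2 * c) = k - c := div_mul_cancel₀ _ h3.ne'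
    simp only [pt_snd]
    linear_combination -this

end Position

/-! ### Local structure of a fine triangulation -/

section Extraction

variable {A B : ℕ} {T : SimplicialComplex ℝ (ℝ × ℝ)} {u : ℝ}

lemma pt_mem_frontPts_of_le {a c b : ℕ} {w : ℝ} {i j : ℕ} (hj : pt w j ∈ frontPts a c b)
    (hij : i ≤ j) : pt w i ∈ frontPts a c b := by
  rcases hj with ⟨k, hk, h⟩ | ⟨k, hk, h⟩ | ⟨k, hk, h⟩ <;> obtain ⟨rfl, rfl⟩ := pt_inj.1 h
  · exact pt_zero_mem_frontPts.2 (hij.trans hk)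
  · exact pt_one_mem_frontPts.2 (hij.trans hk)
  · exact pt_two_mem_frontPts.2 (hij.trans hk)

lemma pt_one_mem_frontPts_of_le_mean {a b k : ℕ} (hu : u = 0 ∨ u = 2)
    (ha : pt u a ∈ frontPts A ((A + B) / 2) B) (hb : pt (2 - u) b ∈ frontPts A ((A + B) / 2) B)
    (h : 2 * k ≤ a + b) : pt 1 k ∈ frontPts A ((A + B) / 2) B := by
  rw [pt_one_mem_frontPts]
  rcases hu with rfl | rfl
  · rw [sub_zero] at hb
    have := pt_zero_mem_frontPts.1 ha
    have := pt_two_mem_frontPts.1 hb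
    omega
  · rw [sub_self] at hb
    have := pt_two_mem_frontPts.1 ha
    have := pt_zero_mem_frontPts.1 hb
    omega

lemma exists_eq_pt {a c b : ℕ} (hu : u = 0 ∨ u = 2) {v : ℝ × ℝ} (hv : v ∈ frontPts a c b) :
    ∃ i, v = pt u i ∨ v = pt 1 i ∨ v = pt (2 - u) i := by
  rcases hu with rfl | rfl <;> rcases hv with ⟨i, -, h⟩ | ⟨i, -, h⟩ | ⟨i, -, h⟩ <;>
    refine ⟨i, ?_⟩ <;> simp [h]

namespace IsFineTriangulation

lemma vertices_eq (hT : IsFineTriangulation (rightTrapezoid A B) T) :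
    T.vertices = frontPts A ((A + B) / 2) B := by
  rw [← latticePoints_rightTrapezoid]
  exact Set.Subset.antisymm hT.1.2 hT.2

lemma mem_frontPts (hT : IsFineTriangulation (rightTrapezoid A B) T) {s : Finset (ℝ × ℝ)}
    (hs : s ∈ T.faces) {v : ℝ × ℝ} (hv : v ∈ s) : v ∈ frontPts A ((A + B) / 2) B := by
  rw [← hT.vertices_eq, SimplicialComplex.vertices_eq]
  exact Set.mem_biUnion hs hv

/-- Fineness acts through this lemma: exhibiting a lattice point in a face forces it to be a vertex,
which pins down the third vertex of each triangle above the front. -/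
lemma mem_of_mem_convexHull (hT : IsFineTriangulation (rightTrapezoid A B) T)
    {s : Finset (ℝ × ℝ)} (hs : s ∈ T.faces) {v : ℝ × ℝ}
    (hv : v ∈ frontPts A ((A + B) / 2) B) (h : v ∈ convexHull ℝ (s : Set (ℝ × ℝ))) : v ∈ s := by
  rw [← hT.vertices_eq] at hv
  exact (SimplicialComplex.vertex_mem_convexHull_iff hv hs).1 h

lemma finite_faces (hT : IsFineTriangulation (rightTrapezoid A B) T) : T.faces.Finite := by
  refine ((finite_frontPts A ((A + B) / 2) B).toFinset.powerset.finite_toSet).subset ?_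
  intro s hs
  simp only [Finset.coe_powerset, Set.mem_preimage, Set.mem_powerset_iff, Set.Finite.coe_toFinset]
  exact fun v hv => hT.mem_frontPts hs hv

lemma exists_insert (hT : IsFineTriangulation (rightTrapezoid A B) T) {s : Finset (ℝ × ℝ)}
    (hs : s ∈ T.faces) {d : ℝ × ℝ × ℝ} (hd : ∀ v ∈ s, affVal d v = 0) {w : ℝ × ℝ}
    (hw : w ∈ frontPts A ((A + B) / 2) B) (hdw : 0 < affVal d w) :
    ∃ v, insert v s ∈ T.faces ∧ 0 < affVal d v := by
  refine SimplicialComplex.exists_insert_mem_faces hT.finite_faces ?_ hs hd ?_ hdw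
  · rw [hT.1.1]; exact convex_convexHull ℝ _
  · rw [hT.1.1]
    rw [← latticePoints_rightTrapezoid] at hw
    exact hw.1

/-- The triangle above an edge from a side column to the middle column. -/
lemma exists_above_side (hT : IsFineTriangulation (rightTrapezoid A B) T) (hu : u = 0 ∨ u = 2)
    {a c : ℕ} (he : {pt u a, pt 1 c} ∈ T.faces) {w : ℝ × ℝ}
    (hw : w ∈ frontPts A ((A + B) / 2) B)
    (haw : a + ((c : ℝ) - a) * ((w.1 - u) * (1 - u)) < w.2) :
    sideTri u a c ∈ T.faces ∨ midTri u a c ∈ T.faces ∨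
      ∃ b, a + b = 2 * c + 1 ∧ {pt u a, pt (2 - u) b, pt 1 c} ∈ T.faces := by
  have hu2 : (1 - u) * (1 - u) = 1 := by rcases hu with rfl | rfl <;> norm_num
  have hu1 : u ≠ 1 := by rcases hu with rfl | rfl <;> norm_num
  -- Since `1 - u` is 1 or -1, `(v.1 - u) * (1 - u)` is the distance from the column `u`, so both
  -- sides are treated at once. The function `d` is the height above the line of the edge.
  set d : ℝ × ℝ × ℝ := (-a + (c - a) * (u * (1 - u)), -((c - a) * (1 - u)), 1) with hd
  have hdv : ∀ v : ℝ × ℝ, affVal d v = v.2 - (a + ((c : ℝ) - a) * ((v.1 - u) * (1 - u))) := by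
    intro v; simp [affVal, hd]; ring
  obtain ⟨v, hv, hdv'⟩ := hT.exists_insert he (d := d) (by
    intro v hv
    simp only [Finset.mem_insert, Finset.mem_singleton] at hv
    rw [hdv]
    rcases hv with rfl | rfl
    · simp
    · simp [hu2]) hw (by rw [hdv]; linarith)
  rw [hdv] at hdv'
  have hvV := hT.mem_frontPts hv (Finset.mem_insert_self _ _)
  have haV : pt u a ∈ frontPts A ((A + B) / 2) B := hT.mem_frontPts hv (by simp)
  have hconv := convex_convexHull ℝ ((insert v {pt u a, pt 1 c} : Finset (ℝ × ℝ)) : Set (ℝ × ℝ))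
  have hvS := mem_convexHull_of_mem (Finset.mem_insert_self v {pt u a, pt 1 c})
  have haS : pt u a ∈ convexHull ℝ
    ((insert v {pt u a, pt 1 c} : Finset (ℝ × ℝ)) : Set (ℝ × ℝ)) := mem_convexHull_of_mem (by simp)
  have hcS : pt 1 c ∈ convexHull ℝ
    ((insert v {pt u a, pt 1 c} : Finset (ℝ × ℝ)) : Set (ℝ × ℝ)) := mem_convexHull_of_mem (by simp)
  obtain ⟨i, rfl | rfl | rfl⟩ := exists_eq_pt hu hvV
  · left
    have hai : a < i := by
      have : (a : ℝ) < i := by simpa using hdv'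
      exact_mod_cast this
    have := hT.mem_of_mem_convexHull hv (pt_mem_frontPts_of_le hvV (i := a + 1) hai)
      (pt_mem_of_between hconv haS hvS (Nat.le_succ a) hai)
    simp [hu1] at this
    convert! hv using 1
    rw [← this, sideTri, Finset.insert_comm]
  · right; left
    have hci : c < i := by
      have : (c : ℝ) < i := by simpa [hu2] using hdv'
      exact_mod_cast this
    have := hT.mem_of_mem_convexHull hv (pt_mem_frontPts_of_le hvV (i := c + 1) hci)
      (pt_mem_of_between hconv hcS hvS (Nat.le_succ c) hci)
    simp [hu1.symm] at this
    convert! hv using 1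
    rw [← this, midTri]
    ext x
    simp only [Finset.mem_insert, Finset.mem_singleton]
    tauto
  · right; right
    have hle : 2 * c < a + i := by
      have h1 : ((2 - u) - u) * (1 - u) = 2 := by linear_combination 2 * hu2
      rw [pt_fst, pt_snd, h1] at hdv'
      have : (2 : ℝ) * c < a + i := by linarith
      exact_mod_cast this
    refine ⟨i, ?_, by rwa [Finset.insert_comm] at hv⟩
    -- If a + i were at least 2c + 2, the triangle would contain (1, c + 1), which is none of its
    -- vertices.
    by_contra hne
    have := hT.mem_of_mem_convexHull hv
      (pt_one_mem_frontPts_of_le_mean hu haV hvV (k := c + 1) (by omega))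
      (pt_one_mem_of_le_mean hconv haS hvS hcS (Nat.lt_succ_self c) (by omega))
    simp [hu1.symm] at this
    rcases hu with rfl | rfl <;> norm_num at this

/-- The triangle above an edge crossing the middle column. -/
lemma crossTri_mem_of_above (hT : IsFineTriangulation (rightTrapezoid A B) T) {a b c : ℕ}
    (hab : a + b = 2 * c + 1) (he : {pt 0 a, pt 2 b} ∈ T.faces) {w : ℝ × ℝ}
    (hw : w ∈ frontPts A ((A + B) / 2) B)
    (haw : a + ((b : ℝ) - a) * (w.1 / 2) < w.2) : crossTri a b (c + 1) ∈ T.faces := by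
  set d : ℝ × ℝ × ℝ := (-a, -((b - a) / 2), 1) with hd
  have hdv : ∀ v : ℝ × ℝ, affVal d v = v.2 - (a + ((b : ℝ) - a) * (v.1 / 2)) := by
    intro v; simp [affVal, hd]; ring
  obtain ⟨v, hv, hdv'⟩ := hT.exists_insert he (d := d) (by
    intro v hv
    simp only [Finset.mem_insert, Finset.mem_singleton] at hv
    rw [hdv]
    rcases hv with rfl | rfl <;> simp) hw (by rw [hdv]; linarith)
  rw [hdv] at hdv'
  have hvV := hT.mem_frontPts hv (Finset.mem_insert_self _ _)
  have haV : pt 0 a ∈ frontPts A ((A + B) / 2) B := hT.mem_frontPts hv (by simp)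
  have hbV : pt 2 b ∈ frontPts A ((A + B) / 2) B := hT.mem_frontPts hv (by simp)
  have hconv := convex_convexHull ℝ ((insert v {pt 0 a, pt 2 b} : Finset (ℝ × ℝ)) : Set (ℝ × ℝ))
  have hvS := mem_convexHull_of_mem (Finset.mem_insert_self v {pt 0 a, pt 2 b})
  have haS : pt 0 a ∈ convexHull ℝ
    ((insert v {pt 0 a, pt 2 b} : Finset (ℝ × ℝ)) : Set (ℝ × ℝ)) := mem_convexHull_of_mem (by simp)
  have hbS : pt 2 b ∈ convexHull ℝ
    ((insert v {pt 0 a, pt 2 b} : Finset (ℝ × ℝ)) : Set (ℝ × ℝ)) := mem_convexHull_of_mem (by simp)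
  have h20 : (2 : ℝ) - 0 = 2 := by norm_num
  rcases hvV with ⟨i, hi, rfl⟩ | ⟨i, hi, rfl⟩ | ⟨i, hi, rfl⟩
  · exfalso
    have hai : a < i := by
      have : (a : ℝ) < i := by simpa using hdv'
      exact_mod_cast this
    have hbB := pt_two_mem_frontPts.1 hbV
    -- A third vertex in the left column would put (0, a + 1) in the triangle, and with it (1, c +
    -- 1), its midpoint with (2, b).
    have h1 := pt_mem_of_between hconv haS hvS (Nat.le_succ a) hai
    have := hT.mem_of_mem_convexHull hv (v := pt 1 (c + 1))
      (pt_one_mem_frontPts.2 (by omega))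
      (pt_one_mem_of_mean hconv h1 (b := b) (by rwa [h20]) (by omega))
    simp at this
  · have hci : c < i := by
      have h1 : (c : ℝ) * 2 + 1 = a + b := by exact_mod_cast (by omega : c * 2 + 1 = a + b)
      have : (c : ℝ) < i := by
        simp at hdv'
        linarith
      exact_mod_cast this
    have h2 : (a : ℝ) + b = 2 * c + 1 := by exact_mod_cast hab
    have h3 : (0 : ℝ) < 2 * i - (2 * c + 1) := by
      have : (c : ℝ) + 1 ≤ i := by exact_mod_cast hci
      linarith
    have h4 : (1 : ℝ) ≤ 2 * i - (2 * c + 1) := by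
      have : (c : ℝ) + 1 ≤ i := by exact_mod_cast hci
      linarith
    -- The crossing edge passes the middle column at c + 1/2, and `t` is the weight of (1, i) that
    -- lifts this point to c + 1.
    set t : ℝ := 1 / (2 * i - (2 * c + 1)) with ht
    have ht0 : 0 ≤ t := by positivity
    have ht1 : t ≤ 1 := by rw [ht, div_le_one h3]; exact h4
    have ht2 : t * (2 * i - (2 * c + 1)) = 1 := by rw [ht]; field_simp
    have hmem := hconv.triple_mem haS hbS hvS (x := (1 - t) / 2) (y := (1 - t) / 2) (z := t)
      (v := pt 1 (c + 1)) (by linarith) (by linarith) ht0 (by ring) (by simp) (by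
        simp only [pt_snd]; push_cast
        linear_combination (-1 / 2 : ℝ) * ht2 - (1 - t) / 2 * h2)
    have := hT.mem_of_mem_convexHull hv (pt_one_mem_frontPts.2 (by omega)) hmem
    simp at this
    convert! hv using 1
    rw [← this, crossTri]
    ext x
    simp only [Finset.mem_insert, Finset.mem_singleton]
    tauto
  · exfalso
    have hbi : b < i := by
      have : (b : ℝ) < i := by simpa using hdv'
      exact_mod_cast this
    have haA := pt_zero_mem_frontPts.1 haV
    have h1 := pt_mem_of_between hconv hbS hvS (Nat.le_succ b) hbi
    have := hT.mem_of_mem_convexHull hv (v := pt 1 (c + 1))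
      (pt_one_mem_frontPts.2 (by omega))
      (pt_one_mem_of_mean hconv haS (b := b + 1) (by rwa [h20]) (by omega))
    simp at this

/-- The midpoint of the segment lies in some face. If an end were not a vertex of that face, an
affine function nonnegative on its vertices would be negative at the midpoint. The exception is an
edge from (u, 0) to (2 - u, 0), which would contain the lattice point (1, 0). -/
lemma bottomEdge_mem (hT : IsFineTriangulation (rightTrapezoid A B) T) (hu : u = 0 ∨ u = 2) :
    {pt u 0, pt 1 0} ∈ T.faces := by
  have hu2 : (1 - u) * (1 - u) = 1 := by rcases hu with rfl | rfl <;> norm_num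
  have hx : ((1 + u) / 2, (0 : ℝ)) ∈ T.space := by
    rw [hT.1.1, mem_rightTrapezoid]
    have hA : (0 : ℝ) ≤ A := by positivity
    have hB : (0 : ℝ) ≤ B := by positivity
    rcases hu with rfl | rfl
    · refine ⟨by norm_num, by norm_num, le_rfl, by linarith⟩
    · refine ⟨by norm_num, by norm_num, le_rfl, by linarith⟩
  obtain ⟨t, ht, hxt⟩ := SimplicialComplex.mem_space_iff.1 hx
  have hut : pt u 0 ∈ t := by
    by_contra hn
    have := affVal_nonneg_of_mem_convexHull (c := (-u * (1 - u) - 1, 1 - u, 1)) (fun v hv => by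
      obtain ⟨i, rfl | rfl | rfl⟩ := exists_eq_pt hu (hT.mem_frontPts ht hv)
      · have hi : i ≠ 0 := by rintro rfl; exact hn hv
        have hi' : (1 : ℝ) ≤ i := by exact_mod_cast Nat.one_le_iff_ne_zero.2 hi
        simp [affVal]; linarith
      · have hi' : (0 : ℝ) ≤ i := by positivity
        simp [affVal]; linarith
      · have hi' : (0 : ℝ) ≤ i := by positivity
        simp [affVal]; linarith) hxt
    simp [affVal] at this
    linarith
  have h1t : pt 1 0 ∈ t := by
    by_contra hn
    have hmem : pt (2 - u) 0 ∈ t := by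
      by_contra hn'
      have := affVal_nonneg_of_mem_convexHull (c := (u * (1 - u), -(1 - u), 2)) (fun v hv => by
        obtain ⟨i, rfl | rfl | rfl⟩ := exists_eq_pt hu (hT.mem_frontPts ht hv)
        · have hi' : (0 : ℝ) ≤ i := by positivity
          simp [affVal]; linarith
        · have hi : i ≠ 0 := by rintro rfl; exact hn hv
          have hi' : (1 : ℝ) ≤ i := by exact_mod_cast Nat.one_le_iff_ne_zero.2 hi
          simp [affVal]; linarith
        · have hi : i ≠ 0 := by rintro rfl; exact hn' hv
          have hi' : (1 : ℝ) ≤ i := by exact_mod_cast Nat.one_le_iff_ne_zero.2 hi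
          simp [affVal]; linarith) hxt
      simp [affVal] at this
      linarith
    exact hn (hT.mem_of_mem_convexHull ht (pt_one_mem_frontPts.2 (Nat.zero_le _))
      (pt_one_mem_of_mean (convex_convexHull ℝ _) (mem_convexHull_of_mem hut)
        (mem_convexHull_of_mem hmem) (by norm_num)))
  exact T.down_closed ht (by
    intro v hv
    simp only [Finset.mem_insert, Finset.mem_singleton] at hv
    rcases hv with rfl | rfl <;> assumption) (by simp)

end IsFineTriangulation

/-! ### Cells that exclude each other -/

namespace Geometry.SimplicialComplex

lemma edge_subset {p q : ℝ × ℝ} (hpq : p ≠ q) (he : {p, q} ∈ T.faces) {t : Finset (ℝ × ℝ)}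
    (ht : t ∈ T.faces) (h : (1 / 2 : ℝ) • p + (1 / 2 : ℝ) • q ∈ convexHull ℝ (t : Set (ℝ × ℝ))) :
    {p, q} ⊆ t :=
  subset_of_mem_convexHull he ht (w := fun _ => 1 / 2) (fun _ _ => by norm_num)
    (by rw [Finset.sum_pair hpq]; norm_num) (by rwa [Finset.sum_pair hpq])

/-- Both edges have the same midpoint on the middle column, so each contains the vertices of the
other. -/
lemma cross_eq {a b a' b' : ℕ} (hab : a + b = a' + b')
    (h : {pt 0 a, pt 2 b} ∈ T.faces) (h' : {pt 0 a', pt 2 b'} ∈ T.faces) : a = a' ∧ b = b' := by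
  have hab' : (a : ℝ) + b = a' + b' := by exact_mod_cast hab
  have := edge_subset (by simp) h h' ((convex_convexHull ℝ _).triple_mem
    (mem_convexHull_of_mem (v := pt 0 a') (by simp))
    (mem_convexHull_of_mem (v := pt 2 b') (by simp))
    (mem_convexHull_of_mem (v := pt 2 b') (by simp)) (x := 1 / 2) (y := 1 / 2) (z := 0)
    (by norm_num) (by norm_num) le_rfl (by norm_num) (by simp) (by simp; linarith))
  have h1 := this (Finset.mem_insert_self _ _)
  simp at h1
  exact ⟨h1, by omega⟩

lemma not_mid_of_cross {a b c : ℕ} (hab : a + b = 2 * c + 1)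
    (h : {pt 0 a, pt 2 b} ∈ T.faces) (h' : {pt 1 c, pt 1 (c + 1)} ∈ T.faces) : False := by
  have hab' : (a : ℝ) + b = 2 * c + 1 := by exact_mod_cast hab
  have := edge_subset (by simp) h h' ((convex_convexHull ℝ _).triple_mem
    (mem_convexHull_of_mem (v := pt 1 c) (by simp))
    (mem_convexHull_of_mem (v := pt 1 (c + 1)) (by simp))
    (mem_convexHull_of_mem (v := pt 1 (c + 1)) (by simp)) (x := 1 / 2) (y := 1 / 2) (z := 0)
    (by norm_num) (by norm_num) le_rfl (by norm_num) (by simp; norm_num) (by simp; linarith))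
  have h1 := this (Finset.mem_insert_self _ _)
  simp at h1

/-- Two triangles on the same side of an edge share points close to the midpoint of that edge, in
the interior of the first. -/
lemma midTri_inj (hu : u ≠ 1) {a a' c : ℕ} (h : midTri u a c ∈ T.faces)
    (h' : midTri u a' c ∈ T.faces) : a = a' := by
  set δ : ℝ := a' - a with hδ
  -- This is small enough that moving the apex by `δ` changes the two edge weights `(1 - ε) / 2` by
  -- at most their size.
  set ε : ℝ := 1 / (2 + 2 * |δ|) with hε
  have hpos : 0 < 2 + 2 * |δ| := by positivity
  have hε0 : 0 < ε := by positivity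
  have hε2 : ε * (2 + 2 * |δ|) = 1 := by rw [hε]; field_simp
  have h1 : ε * δ ≤ ε * |δ| := mul_le_mul_of_nonneg_left (le_abs_self δ) hε0.le
  have h2 : ε * -|δ| ≤ ε * δ := mul_le_mul_of_nonneg_left (neg_abs_le δ) hε0.le
  have h3 : 0 ≤ ε * |δ| := by positivity
  have hne1 : pt u a ≠ pt 1 c := by simp [hu]
  have hne2 : pt u a ≠ pt 1 (c + 1) := by simp [hu]
  have hne3 : pt 1 c ≠ pt 1 (c + 1) := by simp
  classical
  have hsum : ∀ {M : Type} [AddCommMonoid M] (g : ℝ × ℝ → M), ∑ v ∈ midTri u a c, g v =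
      g (pt u a) + (g (pt 1 c) + g (pt 1 (c + 1))) := by
    intro M _ g
    rw [midTri, Finset.sum_insert (by simp [hu]), Finset.sum_pair hne3]
  have hsub := subset_of_mem_convexHull h h'
    (w := fun v => if v = pt u a then ε else (1 - ε) / 2) (fun v _ => by
      split_ifs
      · exact hε0
      · linarith)
    (by rw [hsum]; simp [hne1.symm, hne2.symm])
    ((convex_convexHull ℝ _).triple_mem
      (mem_convexHull_of_mem (v := pt u a') (by simp [midTri]))
      (mem_convexHull_of_mem (v := pt 1 c) (by simp [midTri]))
      (mem_convexHull_of_mem (v := pt 1 (c + 1)) (by simp [midTri]))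
      (x := ε) (y := (1 - ε) / 2 + ε * δ) (z := (1 - ε) / 2 - ε * δ) hε0.le
      (by linarith) (by linarith) (by ring)
      (by rw [hsum]; simp [Ne.symm hu]; ring)
      (by rw [hsum]; simp [Ne.symm hu, hδ]; ring))
  have := hsub (show pt u a ∈ midTri u a c by simp [midTri])
  simpa [midTri, hu] using this

end Geometry.SimplicialComplex

end Extraction

/-! ### From triangulations to rows -/

section Rows

variable {A B : ℕ} {T : SimplicialComplex ℝ (ℝ × ℝ)}

lemma Geometry.SimplicialComplex.pair_mem_faces {s : Finset (ℝ × ℝ)} (hs : s ∈ T.faces)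
    {p q : ℝ × ℝ} (hp : p ∈ s) (hq : q ∈ s) : {p, q} ∈ T.faces :=
  T.down_closed hs (Finset.insert_subset hp (Finset.singleton_subset_iff.2 hq)) (by simp)

lemma cells_subset_frontCells (l : List Row) (a b : ℕ) : cells l ⊆ frontCells l a b :=
  fun _ h => Or.inl (Or.inl h)

lemma frontCells_cons_top (r : Row) (l : List Row) :
    frontCells (r :: l) r.1 r.2.1 = frontCells l r.1 r.2.1 ∪ rowCells r l.length := by
  rw [← cells_cons, ← frontCells_top (r :: l)]; rfl

/-- A fine triangulation containing all cells below a front comes from a sequence of rows. -/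
lemma IsFineTriangulation.exists_rows_of_front (hT : IsFineTriangulation (rightTrapezoid A B) T)
    (N : ℕ) : ∀ (l : List Row) (a b : ℕ), IsRows l → leftTop l ≤ a → rightTop l ≤ b →
      frontCells l a b ⊆ T.faces → {pt 0 a, pt 1 l.length} ∈ T.faces →
      {pt 2 b, pt 1 l.length} ∈ T.faces →
      (A - a) + (B - b) + ((A + B) / 2 - l.length) = N →
      ∃ l', IsRows l' ∧ l'.length = (A + B) / 2 ∧ leftTop l' ≤ A ∧ rightTop l' ≤ B ∧
        totalCells l' A B ⊆ T.faces := by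
  induction N using Nat.strong_induction_on with
  | _ N ih =>
  intro l a b hl hla hlb hsub hleft hright hN
  set c := l.length with hc
  have haA : a ≤ A := pt_zero_mem_frontPts.1 (hT.mem_frontPts hleft (v := pt 0 a) (by simp))
  have hbB : b ≤ B := pt_two_mem_frontPts.1 (hT.mem_frontPts hright (v := pt 2 b) (by simp))
  have hcC : c ≤ (A + B) / 2 :=
    pt_one_mem_frontPts.1 (hT.mem_frontPts hleft (v := pt 1 c) (by simp))
  -- The induction is on the number of lattice points above the front. Side triangles on the front
  -- are absorbed first, since they belong to the current gap between rows.
  by_cases hL : sideTri 0 a c ∈ T.faces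
  · have haA' : a + 1 ≤ A :=
      pt_zero_mem_frontPts.1 (hT.mem_frontPts hL (v := pt 0 (a + 1)) (by simp [sideTri]))
    refine ih _ ?_ l (a + 1) b hl (by omega) hlb ?_ ?_ hright rfl
    · omega
    · rw [frontCells_succ_left hla]
      exact Set.insert_subset hL hsub
    · exact SimplicialComplex.pair_mem_faces hL (by simp [sideTri]) (by simp [sideTri, hc])
  by_cases hR : sideTri 2 b c ∈ T.faces
  · have hbB' : b + 1 ≤ B :=
      pt_two_mem_frontPts.1 (hT.mem_frontPts hR (v := pt 2 (b + 1)) (by simp [sideTri]))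
    refine ih _ ?_ l a (b + 1) hl hla (by omega) ?_ hleft ?_ rfl
    · omega
    · rw [frontCells_succ_right _ hlb]
      exact Set.insert_subset hR hsub
    · exact SimplicialComplex.pair_mem_faces hR (by simp [sideTri]) (by simp [sideTri, hc])
  -- In each of these cases a lattice point lies above the line of the left front edge. In the last
  -- one, when the first two fail, it is (2, B), with only the closing triangle missing.
  have stepL : (a < A ∨ c < (A + B) / 2 ∨ (A + B) % 2 = 1) → midTri 0 a c ∈ T.faces ∨
      ∃ b', a + b' = 2 * c + 1 ∧ {pt 0 a, pt 2 b', pt 1 c} ∈ T.faces := by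
    intro h
    have : ∃ w ∈ frontPts A ((A + B) / 2) B, a + ((c : ℝ) - a) * ((w.1 - 0) * (1 - 0)) < w.2 := by
      by_cases h1 : a < A
      · exact ⟨pt 0 (a + 1), pt_zero_mem_frontPts.2 h1, by simp⟩
      by_cases h2 : c < (A + B) / 2
      · exact ⟨pt 1 (c + 1), pt_one_mem_frontPts.2 h2, by simp⟩
      refine ⟨pt 2 B, pt_two_mem_frontPts.2 le_rfl, ?_⟩
      have h3 : 2 * c + 1 = a + B := by omega
      have h4 : (2 : ℝ) * c + 1 = a + B := by exact_mod_cast h3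
      simp; linarith
    obtain ⟨w, hw, haw⟩ := this
    rcases hT.exists_above_side (Or.inl rfl) hleft hw haw with h | h | ⟨b', h, h'⟩
    · exact absurd h hL
    · exact Or.inl h
    · exact Or.inr ⟨b', h, by rwa [sub_zero] at h'⟩
  have stepR : (b < B ∨ c < (A + B) / 2 ∨ (A + B) % 2 = 1) → midTri 2 b c ∈ T.faces ∨
      ∃ a', b + a' = 2 * c + 1 ∧ {pt 2 b, pt 0 a', pt 1 c} ∈ T.faces := by
    intro h
    have : ∃ w ∈ frontPts A ((A + B) / 2) B, b + ((c : ℝ) - b) * ((w.1 - 2) * (1 - 2)) < w.2 := by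
      by_cases h1 : b < B
      · exact ⟨pt 2 (b + 1), pt_two_mem_frontPts.2 h1, by simp⟩
      by_cases h2 : c < (A + B) / 2
      · exact ⟨pt 1 (c + 1), pt_one_mem_frontPts.2 h2, by simp; norm_num⟩
      refine ⟨pt 0 A, pt_zero_mem_frontPts.2 le_rfl, ?_⟩
      have h3 : 2 * c + 1 = A + b := by omega
      have h4 : (2 : ℝ) * c + 1 = A + b := by exact_mod_cast h3
      simp; linarith
    obtain ⟨w, hw, haw⟩ := this
    rcases hT.exists_above_side (Or.inr rfl) hright hw haw with h | h | ⟨b', h, h'⟩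
    · exact absurd h hR
    · exact Or.inl h
    · exact Or.inr ⟨b', h, by rwa [sub_self] at h'⟩
  have mid_le : ∀ {u : ℝ} {i : ℕ}, midTri u i c ∈ T.faces → c + 1 ≤ (A + B) / 2 := fun h =>
    pt_one_mem_frontPts.1 (hT.mem_frontPts h (v := pt 1 (c + 1)) (by simp [midTri]))
  by_cases htop : c = (A + B) / 2 ∧ (A + B) % 2 = 0
  · have haA' : a = A := by
      by_contra hne
      rcases stepL (Or.inl (by omega)) with h | ⟨b', h, h'⟩
      · have := mid_le h
        omega
      · have := pt_two_mem_frontPts.1 (hT.mem_frontPts h' (v := pt 2 b') (by simp))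
        omega
    have hbB' : b = B := by
      by_contra hne
      rcases stepR (Or.inl (by omega)) with h | ⟨b', h, h'⟩
      · have := mid_le h
        omega
      · have := pt_zero_mem_frontPts.1 (hT.mem_frontPts h' (v := pt 0 b') (by simp))
        omega
    subst haA' hbB'
    exact ⟨l, hl, htop.1, hla, hlb, by rwa [totalCells, if_neg (by omega)]⟩
  have hmid : ∀ {u : ℝ} {i : ℕ}, midTri u i c ∈ T.faces → {pt 1 c, pt 1 (c + 1)} ∈ T.faces := by
    intro u i h
    exact SimplicialComplex.pair_mem_faces h (by simp [midTri]) (by simp [midTri])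
  have hpush : ∀ f, (f = true → a + b = 2 * c + 1) → rowCells (a, b, f) c ⊆ T.faces →
      c + 1 ≤ (A + B) / 2 → {pt 0 a, pt 1 (c + 1)} ∈ T.faces →
      {pt 2 b, pt 1 (c + 1)} ∈ T.faces →
      ∃ l', IsRows l' ∧ l'.length = (A + B) / 2 ∧ leftTop l' ≤ A ∧ rightTop l' ≤ B ∧
        totalCells l' A B ⊆ T.faces := by
    intro f hf hrow hle h0 h2
    refine ih _ ?_ ((a, b, f) :: l) a b ⟨hla, hlb, hf, hl⟩ le_rfl le_rfl ?_ h0 h2 rfl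
    · rw [List.length_cons]
      omega
    · rw [frontCells_cons_top (a, b, f) l]
      exact Set.union_subset hsub hrow
  -- In the mixed cases an edge from the left to the right column would cross a middle edge at its
  -- midpoint.
  rcases stepL (by omega) with hl0 | ⟨b', hb', hl0⟩ <;>
    rcases stepR (by omega) with hr0 | ⟨a', ha', hr0⟩
  · refine hpush false (by simp) ?_ (mid_le hl0) ?_ ?_
    · rintro σ (rfl | rfl)
      exacts [hl0, hr0]
    · exact SimplicialComplex.pair_mem_faces hl0 (by simp [midTri]) (by simp [midTri])
    · exact SimplicialComplex.pair_mem_faces hr0 (by simp [midTri]) (by simp [midTri])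
  · exact (SimplicialComplex.not_mid_of_cross (a := a') (b := b) (by omega)
      (SimplicialComplex.pair_mem_faces hr0 (by simp) (by simp)) (hmid hl0)).elim
  · exact (SimplicialComplex.not_mid_of_cross (a := a) (b := b') (by omega)
      (SimplicialComplex.pair_mem_faces hl0 (by simp) (by simp)) (hmid hr0)).elim
  · have he : {pt 0 a, pt 2 b'} ∈ T.faces :=
      SimplicialComplex.pair_mem_faces hl0 (by simp) (by simp)
    have he' : {pt 0 a', pt 2 b} ∈ T.faces :=
      SimplicialComplex.pair_mem_faces hr0 (by simp) (by simp)
    obtain ⟨-, rfl⟩ := SimplicialComplex.cross_eq (by omega) he he'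
    -- If the slanted edge is the top edge, the triangle below it is the closing one. Otherwise a
    -- triangle above it completes a flagged row.
    by_cases hfin : a = A ∧ b' = B
    · obtain ⟨rfl, rfl⟩ := hfin
      refine ⟨l, hl, by omega, hla, hlb, ?_⟩
      rw [totalCells, if_pos (by omega)]
      exact Set.insert_subset hl0 hsub
    · have hw : ∃ w ∈ frontPts A ((A + B) / 2) B, a + ((b' : ℝ) - a) * (w.1 / 2) < w.2 := by
        by_cases h1 : a < A
        · exact ⟨pt 0 (a + 1), pt_zero_mem_frontPts.2 h1, by simp⟩
        · exact ⟨pt 2 (b' + 1), pt_two_mem_frontPts.2 (by omega), by simp⟩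
      obtain ⟨w, hw, haw⟩ := hw
      have hup := hT.crossTri_mem_of_above hb' he hw haw
      refine hpush true (fun _ => hb') ?_ (by omega) ?_ ?_
      · rintro σ (rfl | rfl)
        exacts [hl0, hup]
      · exact SimplicialComplex.pair_mem_faces hup (by simp [crossTri]) (by simp [crossTri])
      · exact SimplicialComplex.pair_mem_faces hup (by simp [crossTri]) (by simp [crossTri])

lemma IsFineTriangulation.exists_rows (hT : IsFineTriangulation (rightTrapezoid A B) T) :
    ∃ l, IsRows l ∧ l.length = (A + B) / 2 ∧ leftTop l ≤ A ∧ rightTop l ≤ B ∧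
      totalCells l A B ⊆ T.faces := by
  refine hT.exists_rows_of_front _ [] 0 0 trivial le_rfl le_rfl ?_ (hT.bottomEdge_mem (Or.inl rfl))
    (hT.bottomEdge_mem (Or.inr rfl)) rfl
  have : frontCells [] 0 0 = bottomEdges := frontCells_top []
  rw [this]
  rintro σ (rfl | rfl)
  exacts [hT.bottomEdge_mem (Or.inl rfl), hT.bottomEdge_mem (Or.inr rfl)]

/-- The flag records which of two crossing edges is present, so it is determined by the complex. The
apices then follow from `midTri_inj` or `cross_eq`. -/
lemma row_eq_of_rowCells_subset {r r' : Row} {c : ℕ}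
    (hr : r.2.2 = true → r.1 + r.2.1 = 2 * c + 1)
    (hr' : r'.2.2 = true → r'.1 + r'.2.1 = 2 * c + 1) (h : rowCells r c ⊆ T.faces)
    (h' : rowCells r' c ⊆ T.faces) : r = r' := by
  have cross : ∀ {a b : ℕ}, rowCells (a, b, true) c ⊆ T.faces → {pt 0 a, pt 2 b} ∈ T.faces := by
    intro a b h
    exact SimplicialComplex.pair_mem_faces (h (Or.inl rfl)) (by simp [crossTri]) (by simp [crossTri])
  have mid : ∀ {a b : ℕ}, rowCells (a, b, false) c ⊆ T.faces →
      {pt 1 c, pt 1 (c + 1)} ∈ T.faces := by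
    intro a b h
    exact SimplicialComplex.pair_mem_faces (h (Or.inl rfl)) (by simp [midTri]) (by simp [midTri])
  obtain ⟨a, b, f⟩ := r
  obtain ⟨a', b', f'⟩ := r'
  cases f <;> cases f'
  · obtain rfl := SimplicialComplex.midTri_inj (by norm_num) (h (Or.inl rfl)) (h' (Or.inl rfl))
    obtain rfl := SimplicialComplex.midTri_inj (by norm_num) (h (Or.inr rfl)) (h' (Or.inr rfl))
    rfl
  · exact (SimplicialComplex.not_mid_of_cross (hr' rfl) (cross h') (mid h)).elim
  · exact (SimplicialComplex.not_mid_of_cross (hr rfl) (cross h) (mid h')).elim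
  · obtain ⟨rfl, rfl⟩ := SimplicialComplex.cross_eq ((hr rfl).trans (hr' rfl).symm)
      (cross h) (cross h')
    rfl

lemma eq_of_cells_subset : ∀ {l l' : List Row}, IsRows l → IsRows l' → l.length = l'.length →
    cells l ⊆ T.faces → cells l' ⊆ T.faces → l = l'
  | [], [], _, _, _, _, _ => rfl
  | [], _ :: _, _, _, h, _, _ => by simp at h
  | _ :: _, [], _, _, h, _, _ => by simp at h
  | r :: l, r' :: l', hl, hl', hlen, h, h' => by
    have hlen' : l.length = l'.length := by simpa using hlen
    have h1 : l = l' := eq_of_cells_subset hl.2.2.2 hl'.2.2.2 hlen'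
      (fun _ hσ => h (Or.inl (Or.inl (Or.inl hσ)))) (fun _ hσ => h' (Or.inl (Or.inl (Or.inl hσ))))
    subst h1
    rw [row_eq_of_rowCells_subset hl.2.2.1 hl'.2.2.1 (fun _ hσ => h (Or.inr hσ))
      (fun _ hσ => h' (Or.inr hσ))]

lemma cells_subset_totalCells (l : List Row) (a b : ℕ) : cells l ⊆ totalCells l a b := by
  rw [totalCells]
  split_ifs
  · exact (cells_subset_frontCells l a b).trans (Set.subset_insert _ _)
  · exact cells_subset_frontCells l a b

end Rows

/-! ### Counting row sequences -/

/-- All sequences of `c` rows below the heights `a` and `b`. -/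
def rowLists : ℕ → ℕ → ℕ → Finset (List Row)
  | 0, _, _ => {[]}
  | c + 1, a, b => (Finset.range (a + 1) ×ˢ Finset.range (b + 1)).biUnion fun p =>
      ((Finset.univ : Finset Bool).filter fun f => f = true → p.1 + p.2 = 2 * c + 1).biUnion
        fun f => (rowLists c p.1 p.2).image fun l => (p.1, p.2, f) :: l

lemma mem_rowLists {l : List Row} : ∀ {c a b : ℕ}, l ∈ rowLists c a b ↔
    IsRows l ∧ l.length = c ∧ leftTop l ≤ a ∧ rightTop l ≤ b := by
  induction l with
  | nil =>
    intro c a b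
    cases c with
    | zero => simp [rowLists, IsRows, leftTop, rightTop]
    | succ c => simp [rowLists]
  | cons r l ih =>
    intro c a b
    obtain ⟨a', b', f⟩ := r
    cases c with
    | zero => simp [rowLists]
    | succ c =>
      simp only [rowLists, Finset.mem_biUnion, Finset.mem_product, Finset.mem_range,
        Finset.mem_filter, Finset.mem_univ, true_and, Finset.mem_image, IsRows,
        List.length_cons, leftTop, rightTop, List.cons.injEq, Prod.mk.injEq, Prod.exists]
      constructor
      · rintro ⟨x, y, ⟨hx, hy⟩, g, hg, l', h, ⟨rfl, rfl, rfl⟩, rfl⟩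
        obtain ⟨h1, rfl, h3, h4⟩ := ih.1 h
        exact ⟨⟨h3, h4, hg, h1⟩, rfl, by omega, by omega⟩
      · rintro ⟨⟨h3, h4, hg, h1⟩, hc, hx, hy⟩
        obtain rfl : l.length = c := by omega
        exact ⟨a', b', ⟨by omega, by omega⟩, f, hg, l, ih.2 ⟨h1, rfl, h3, h4⟩, ⟨rfl, rfl, rfl⟩, rfl⟩

/-- The fine triangulations of a trapezoid of width two correspond to sequences of rows. -/
lemma numFT_rightTrapezoid (A B : ℕ) :
    numFT (rightTrapezoid A B) = (rowLists ((A + B) / 2) A B).card := by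
  rw [numFT, ← Set.ncard_coe_finset]
  symm
  have key : ∀ l ∈ ((rowLists ((A + B) / 2) A B : Finset (List Row)) : Set (List Row)),
      ∃ T : SimplicialComplex ℝ (ℝ × ℝ), IsFineTriangulation (rightTrapezoid A B) T ∧
        totalCells l A B ⊆ T.faces := by
    intro l hl
    obtain ⟨h1, h2, h3, h4⟩ := mem_rowLists.1 hl
    obtain ⟨T, hT, -, hsub⟩ := exists_triangulation h1 h2 h3 h4
    exact ⟨T, hT, hsub⟩
  choose f hf hsub using key
  refine Set.ncard_congr f hf ?_ ?_
  · intro l l' hl hl' he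
    obtain ⟨h1, h2, -⟩ := mem_rowLists.1 hl
    obtain ⟨h1', h2', -⟩ := mem_rowLists.1 hl'
    refine eq_of_cells_subset (T := f l hl) h1 h1' (h2.trans h2'.symm)
      ((cells_subset_totalCells l A B).trans (hsub l hl)) ?_
    rw [he]
    exact (cells_subset_totalCells l' A B).trans (hsub l' hl')
  · intro T hT
    obtain ⟨l, h1, h2, h3, h4, h5⟩ := IsFineTriangulation.exists_rows hT
    have hl := mem_rowLists.2 ⟨h1, h2, h3, h4⟩
    exact ⟨l, hl, eq_of_totalCells_subset h1 h2 h3 h4 (hf l hl) hT (hsub l hl) h5⟩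

/-- All fine triangulations of a trapezoid of width two are regular. -/
lemma IsFineTriangulation.isRegularTriangulation {A B : ℕ} {T : SimplicialComplex ℝ (ℝ × ℝ)}
    (hT : IsFineTriangulation (rightTrapezoid A B) T) :
    IsRegularTriangulation (rightTrapezoid A B) T := by
  obtain ⟨l, h1, h2, h3, h4, h5⟩ := hT.exists_rows
  obtain ⟨T', hT', hreg, hsub⟩ := exists_triangulation h1 h2 h3 h4
  rwa [eq_of_totalCells_subset h1 h2 h3 h4 hT hT' h5 hsub]

/-- The top row is split off. The factor 2 counts the choices of its flag. -/
lemma card_rowLists_succ (c a b : ℕ) : (rowLists (c + 1) a b).card =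
    ∑ p ∈ Finset.range (a + 1) ×ˢ Finset.range (b + 1),
      (if p.1 + p.2 = 2 * c + 1 then 2 else 1) * (rowLists c p.1 p.2).card := by
  rw [rowLists, Finset.card_biUnion]
  · refine Finset.sum_congr rfl fun p _ => ?_
    rw [Finset.card_biUnion]
    · have : ∀ f : Bool, ((rowLists c p.1 p.2).image fun l => (p.1, p.2, f) :: l).card =
          (rowLists c p.1 p.2).card := fun f =>
        Finset.card_image_of_injective _ fun l l' h => by simpa using h
      rw [Finset.sum_congr rfl fun f _ => this f, Finset.sum_const, smul_eq_mul]
      congr 1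
      split_ifs with h
      · simp [h]
      · rw [show (Finset.univ.filter fun f : Bool => f = true → p.1 + p.2 = 2 * c + 1) = {false} by
          ext f; cases f <;> simp [h], Finset.card_singleton]
    · intro f _ g _ hfg
      refine Finset.disjoint_left.2 ?_
      intro l hl hl'
      obtain ⟨x, -, rfl⟩ := Finset.mem_image.1 hl
      obtain ⟨y, -, hy⟩ := Finset.mem_image.1 hl'
      simp only [List.cons.injEq, Prod.mk.injEq] at hy
      exact hfg hy.1.2.2.symm
  · intro p _ q _ hpq
    refine Finset.disjoint_left.2 ?_
    intro l hl hl'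
    simp only [Finset.mem_biUnion, Finset.mem_image] at hl hl'
    obtain ⟨f, -, x, -, rfl⟩ := hl
    obtain ⟨g, -, y, -, hy⟩ := hl'
    simp only [List.cons.injEq, Prod.mk.injEq] at hy
    exact hpq (Prod.ext hy.1.1.symm hy.1.2.1.symm)

/-- This is the hockey-stick identity, weighted by `F` over the starting point. -/
lemma sum_sum_mul_choose (F : ℕ → ℕ) (m a : ℕ) :
    ∑ x ∈ Finset.range (a + 1), ∑ i ∈ Finset.range (x + 1), F i * (x - i + m).choose m =
      ∑ i ∈ Finset.range (a + 1), F i * (a - i + (m + 1)).choose (m + 1) := by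
  induction a with
  | zero => simp
  | succ a ih =>
    rw [Finset.sum_range_succ, ih, Finset.sum_range_succ _ (a + 1), ← add_assoc,
      ← Finset.sum_add_distrib, Finset.sum_range_succ _ (a + 1)]
    congr 1
    · refine Finset.sum_congr rfl fun i hi => ?_
      have hi' : i ≤ a := Nat.lt_succ_iff.1 (Finset.mem_range.1 hi)
      rw [show a + 1 - i + (m + 1) = (a - i + (m + 1)) + 1 by omega, Nat.choose_succ_succ,
        show a + 1 - i + m = a - i + (m + 1) by omega]
      ring
    · simp

/-- Convolution of `G` with the binomial coefficients counting pairs of lattice paths. -/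
def chooseSum (G : ℕ → ℕ → ℕ) (m a b : ℕ) : ℕ :=
  ∑ i ∈ Finset.range (a + 1), ∑ j ∈ Finset.range (b + 1),
    G i j * (a - i + m).choose m * (b - j + m).choose m

/-- Adding one unflagged row on top sums over its two apices, and each sum raises one binomial index
by the hockey-stick identity. -/
lemma sum_chooseSum (G : ℕ → ℕ → ℕ) (m a b : ℕ) :
    ∑ x ∈ Finset.range (a + 1), ∑ y ∈ Finset.range (b + 1), chooseSum G m x y =
      chooseSum G (m + 1) a b := by
  have h1 : ∀ x, ∑ y ∈ Finset.range (b + 1), chooseSum G m x y =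
      ∑ i ∈ Finset.range (x + 1),
        (∑ j ∈ Finset.range (b + 1), G i j * (b - j + (m + 1)).choose (m + 1)) *
          (x - i + m).choose m := by
    intro x
    simp only [chooseSum]
    rw [Finset.sum_comm]
    refine Finset.sum_congr rfl fun i _ => ?_
    rw [← sum_sum_mul_choose, Finset.sum_mul]
    refine Finset.sum_congr rfl fun y _ => ?_
    rw [Finset.sum_mul]
    exact Finset.sum_congr rfl fun j _ => by ring
  rw [Finset.sum_congr rfl fun x _ => h1 x, sum_sum_mul_choose, chooseSum]
  refine Finset.sum_congr rfl fun i _ => ?_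
  rw [Finset.sum_mul]
  exact Finset.sum_congr rfl fun j _ => by ring

/-- Counting row sequences by their last flipped row. -/
lemma card_rowLists (c : ℕ) : ∀ a b, (rowLists c a b).card =
    (a + c).choose c * (b + c).choose c + ∑ j ∈ Finset.range c,
      chooseSum (fun x y => if x + y = 2 * j + 1 then (rowLists j x y).card else 0)
        (c - 1 - j) a b := by
  induction c with
  | zero => simp [rowLists]
  | succ c ih =>
    intro a b
    -- The first summand is an unflagged top row, to which induction applies. The second is a
    -- flagged top row, the new term j = c, whose binomials are trivial.
    have hsplit : ∀ p : ℕ × ℕ, (if p.1 + p.2 = 2 * c + 1 then 2 else 1) *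
        (rowLists c p.1 p.2).card = (rowLists c p.1 p.2).card +
        (if p.1 + p.2 = 2 * c + 1 then (rowLists c p.1 p.2).card else 0) := by
      intro p
      split_ifs <;> ring
    have hlast : chooseSum (fun x y => if x + y = 2 * c + 1 then (rowLists c x y).card else 0)
        (c + 1 - 1 - c) a b = ∑ x ∈ Finset.range (a + 1), ∑ y ∈ Finset.range (b + 1),
          if x + y = 2 * c + 1 then (rowLists c x y).card else 0 := by
      simp [chooseSum]
    rw [card_rowLists_succ, Finset.sum_congr rfl fun p _ => hsplit p, Finset.sum_add_distrib,
      Finset.sum_product, Finset.sum_product, Finset.sum_range_succ _ c, hlast, ← add_assoc]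
    congr 1
    simp only [ih, Finset.sum_add_distrib]
    congr 1
    · rw [← add_assoc a c 1, ← add_assoc b c 1, ← Nat.sum_range_add_choose,
        ← Nat.sum_range_add_choose, Finset.sum_mul_sum]
    · have : ∀ x, ∑ y ∈ Finset.range (b + 1), ∑ j ∈ Finset.range c, chooseSum (fun x y =>
          if x + y = 2 * j + 1 then (rowLists j x y).card else 0) (c - 1 - j) x y =
          ∑ j ∈ Finset.range c, ∑ y ∈ Finset.range (b + 1), chooseSum (fun x y =>
          if x + y = 2 * j + 1 then (rowLists j x y).card else 0) (c - 1 - j) x y :=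
        fun x => Finset.sum_comm
      rw [Finset.sum_congr rfl fun x _ => this x, Finset.sum_comm]
      refine Finset.sum_congr rfl fun j hj => ?_
      have hj' := Finset.mem_range.1 hj
      rw [sum_chooseSum, show c + 1 - 1 - j = c - 1 - j + 1 by omega]

theorem mainTheorem5 (n k : ℕ) :
    fTwo n k =
        Nat.choose (2 * n + k) n * Nat.choose (2 * n + 3 * k) (n + 2 * k) +
          ∑ p ∈ (Finset.Icc 0 n ×ˢ Finset.Icc 0 (n + 2 * k)).filter
              (fun p => p.1 + p.2 ≡ 1 [MOD 2]),
            gTwo p.1 p.2 *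
              Nat.choose (2 * n + k - (3 * p.1 + p.2 + 1) / 2) (n - p.1) *
              Nat.choose (2 * n + 3 * k - (p.1 + 3 * p.2 + 1) / 2) (n + 2 * k - p.2) ∧
      fRegTwo n k = fTwo n k := by
  constructor
  · rw [fTwo, numFT_rightTrapezoid, show (n + (n + 2 * k)) / 2 = n + k by omega, card_rowLists]
    congr 1
    · rw [← Nat.choose_symm_add, ← Nat.choose_symm_add, show n + (n + k) = 2 * n + k by ring,
        show n + 2 * k + (n + k) = 2 * n + 3 * k by ring]
    · have hIcc : ∀ m : ℕ, Finset.Icc 0 m = Finset.range (m + 1) := fun m => by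
        ext i; simp
      simp only [chooseSum]
      rw [Finset.sum_filter, Finset.sum_product, hIcc, hIcc, Finset.sum_comm]
      refine Finset.sum_congr rfl fun x hx => ?_
      rw [Finset.sum_comm]
      refine Finset.sum_congr rfl fun y hy => ?_
      have hx' := Finset.mem_range.1 hx
      have hy' := Finset.mem_range.1 hy
      simp only [gTwo, numFT_rightTrapezoid, Nat.ModEq]
      split_ifs with hpar
      · have hj : x + y = 2 * ((x + y) / 2) + 1 := by omega
        -- The apices determine the index of the last flagged row, so the sum over `j` has a single
        -- term. That index is below n + k because x + y is odd and at most 2n + 2k.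
        rw [Finset.sum_eq_single ((x + y) / 2)]
        · rw [if_pos hj, ← Nat.choose_symm_add, ← Nat.choose_symm_add]
          congr 2
          · congr 1
            omega
          · omega
        · intro j _ hne
          rw [if_neg (by omega), zero_mul, zero_mul]
        · intro h
          exact absurd (Finset.mem_range.2 (by omega)) h
      · refine Finset.sum_eq_zero fun j _ => ?_
        rw [if_neg (by omega), zero_mul, zero_mul]
  · rw [fRegTwo, fTwo, numFRT, numFT]
    congr 1
    ext T
    exact ⟨fun h => h.1, fun h => ⟨h, h.isRegularTriangulation⟩⟩
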